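/- **Setting.** Let $X$ be a real Banach space and $Z,V$ real Hilbert spaces with $Z\hookrightarrow V$ densely and compactly, $\|z\|_V\le\|z\|_Z$ for $z\in Z$, and $V\hookrightarrow X$ continuously. Let $T>0$ and $$I:[0,T]\times Z\to\mathbb R,\qquad I(t,z)=\tfrac12\langle Az,z\rangle_{Z^*,Z}+F(z)-\langle \ell(t),z\rangle_{V^*,V},$$ where $A:Z\to Z^*$ is linear, bounded, self-adjoint and coercive ($\langle Az,z\rangle\ge\alpha\|z\|_Z^2$ for some $\alpha>0$); $\ell:[0,T]\to V^*$ is Lipschitz continuous; $F\in C^2(Z;\mathbb R)$, $F\ge 0$, $DF\in C^1(Z;V^*)$ and $\|D^2F(z)v\|_{V^*}\le C_F(1+\|z\|_Z^q)\|v\|_Z$ for some $C_F$ and $q\ge1$; and for all $t\in[0,T]$ and $r>0$ there is $C(r)\ge0$ with $\langle[D_z^2I(t,z_1)-D_z^2I(t,z_2)]v,v\rangle\le C(r)\|z_1-z_2\|_Z\|v\|_Z^2$ for all $\|z_1\|_Z,\|z_2\|_Z<r$, $v\in Z$. Let $R:V\to[0,\infty)$ be convex, lower semicontinuous and positively homogeneous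 of degree one, with $\underline\rho\|v\|_X\le R(v)\le\overline\rho\|v\|_V$ for all $v\in V$ and some $\underline\rho,\overline\rho>0$. Let $z_0\in Z$ with $0\in\partial R(0)+D_zI(0,z_0)$. Here $\partial R(u)=\{\xi\in Z^*: R(w)\ge R(u)+\langle\xi,w-u\rangle\ \forall w\in Z\}$ for $u\in Z$. A *differential solution* is a function $z\in W^{1,1}(0,T;Z)$ with $z(0)=z_0$ and $0\in\partial R(z'(t))+D_zI(t,z(t))$ for almost all $t\in[0,T]$. **Scheme.** For $\tau>0$, iterates of the local incremental minimization scheme are sequences with $t_0=0$, the given $z_0$, and for $k\ge1$ $$z_k\in\operatorname{argmin}\{I(t_{k-1},y)+R(y-z_{k-1}):\ y\in Z,\ \|y-z_{k-1}\|_V\le\tau\},\qquad t_k=\min\{t_{k-1}+\tau-\|z_k-z_{k-1}\|_V,\;T\}.$$ Let $N(\tau)$ be the first index with $t_{N(\tau)}=T$ (if there is one), $S_\tau=N(\tau)\tau$, and let $\hat t_\tau,\hat z_\tau$ be the continuous piecewise affine interpolants on $[0,S_\tau]$ of $(t_k)$ and $(z_k)$ with nodes $s_k=k\tau$. If $\hat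 t_\tau:[0,S_\tau]\to[0,T]$ is bijective, the *back-transformed* discrete solution is $z_\tau=\hat z_\tau\circ\hat t_\tau^{-1}:[0,T]\to Z$. **Theorem 3.18.** Let $z\in C^{0,1}([0,T];Z)$ be a differential solution. Suppose that there are $\kappa,\Delta>0$ with $$\langle D_z^2I(t,y)v,v\rangle_{Z^*,Z}\ \ge\ \kappa\|v\|_Z^2\qquad\text{for all } t\in[0,T],\ v\in Z,\ y\in Z \text{ with } \|y-z(t)\|_Z\le\Delta .$$ Assume further that $\ell$ has a Lipschitz constant $|\ell|_{Lip}\le\kappa-\delta$ for some $\delta\in(0,\kappa]$, and that $\ell'\in BV([0,T];V^*)$. Then there are constants $K_{loc}>0$ and $\bar\tau>0$ such that for every $\tau\in(0,\bar\tau]$ iterates of the scheme exist and, for every choice of the iterates, the final time $T$ is reached after finitely many steps, $\hat t_\tau$ is a strictly increasing bijection from $[0,S_\tau]$ onto $[0,T]$, and $$\|z_\tau(t)-z(t)\|_Z<\Delta\qquad\text{and}\qquad \|z_\tau(t)-z(t)\|_Z\le K_{loc}\,\tau\qquad\text{for all } t\in[0,T].$$ -/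

import Mathlib

open Set MeasureTheory
open scoped NNReal

namespace LocalMin

/-- The subdifferential of a real functional `J` on a normed space `E` at `u`. -/
def subdifferential {E : Type*} [NormedAddCommGroup E] [NormedSpace ℝ E]
    (J : E → ℝ) (u : E) : Set (E →L[ℝ] ℝ) :=
  {ξ | ∀ w : E, J u + ξ (w - u) ≤ J w}

/-- `u` belongs to `W^{1,1}(0,T;E)` with derivative `u'` (continuous representative):
`u'` is Bochner integrable and `u` is a primitive of `u'` on `[0,T]`. -/
def HasW11Deriv {E : Type*} [NormedAddCommGroup E] [NormedSpace ℝ E]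
    (T : ℝ) (u u' : ℝ → E) : Prop :=
  IntervalIntegrable u' volume 0 T ∧
    ∀ t ∈ Icc (0 : ℝ) T, u t = u 0 + ∫ s in (0 : ℝ)..t, u' s

/-- `u ∈ W^{1,1}(0,T;E)` has a derivative that (for a suitable representative) is of
bounded variation on `[0,T]`. -/
def HasBVDeriv {E : Type*} [NormedAddCommGroup E] [NormedSpace ℝ E]
    (T : ℝ) (u : ℝ → E) : Prop :=
  ∃ u' : ℝ → E, HasW11Deriv T u u' ∧ BoundedVariationOn u' (Icc 0 T)

/-- The data of a rate-independent system. The laws are in `System.Admissible`. -/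
structure System (Z V X : Type*)
    [NormedAddCommGroup Z] [InnerProductSpace ℝ Z]
    [NormedAddCommGroup V] [InnerProductSpace ℝ V]
    [NormedAddCommGroup X] [NormedSpace ℝ X] where
  /-- final time -/
  T : ℝ
  /-- the embedding of `Z` into `V` -/
  ι : Z →L[ℝ] V
  /-- the embedding of `V` into `X` -/
  j : V →L[ℝ] X
  /-- the linear operator of the quadratic part of the energy -/
  A : Z →L[ℝ] (Z →L[ℝ] ℝ)
  /-- the non-quadratic part of the energy -/
  F : Z → ℝ
  /-- the driving force, with values in the dual of `V` (only its values on `[0,T]` matter) -/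
  ℓ : ℝ → (V →L[ℝ] ℝ)
  /-- the dissipation potential -/
  R : V → ℝ
  /-- the initial state -/
  z₀ : Z

variable {Z V X : Type*}
    [NormedAddCommGroup Z] [InnerProductSpace ℝ Z]
    [NormedAddCommGroup V] [InnerProductSpace ℝ V]
    [NormedAddCommGroup X] [NormedSpace ℝ X]

/-- The energy `I(t,z) = ½⟨Az,z⟩ + F(z) - ⟨ℓ(t),z⟩`. -/
noncomputable def System.energy (S : System Z V X) (t : ℝ) (z : Z) : ℝ :=
  (1 / 2) * S.A z z + S.F z - S.ℓ t (S.ι z)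

/-- The partial derivative `D_z I(t,z)`, an element of the dual of `Z`. -/
noncomputable def System.dEnergy (S : System Z V X) (t : ℝ) (z : Z) : Z →L[ℝ] ℝ :=
  fderiv ℝ (S.energy t) z

/-- The second partial derivative `D_z² I(t,z)`. -/
noncomputable def System.d2Energy (S : System Z V X) (t : ℝ) (z : Z) : Z →L[ℝ] (Z →L[ℝ] ℝ) :=
  fderiv ℝ (S.dEnergy t) z

/-- The dissipation potential restricted to `Z`. -/
def System.dissipation (S : System Z V X) (z : Z) : ℝ := S.R (S.ι z)

/-- The standing assumptions on the data. -/
structure System.Admissible (S : System Z V X) : Prop where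
  T_pos : 0 < S.T
  -- dense and compact embedding of `Z` into `V` with constant one, embedding of `V` into `X`
  ι_injective : Function.Injective S.ι
  ι_dense : DenseRange S.ι
  ι_compact : IsCompactOperator S.ι
  ι_norm_le : ∀ z, ‖S.ι z‖ ≤ ‖z‖
  j_injective : Function.Injective S.j
  -- the quadratic part
  A_symm : ∀ u v, S.A u v = S.A v u
  A_coercive : ∃ α : ℝ, 0 < α ∧ ∀ z, α * ‖z‖ ^ 2 ≤ S.A z z
  -- the driving force
  ℓ_lipschitz : ∃ L : ℝ≥0, LipschitzOnWith L S.ℓ (Icc 0 S.T)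
  -- the non-quadratic part: nonnegative, twice continuously differentiable, and of lower order
  F_nonneg : ∀ z, 0 ≤ S.F z
  F_contDiff : ContDiff ℝ 2 S.F
  F_lower_order : ∃ G : Z → (V →L[ℝ] ℝ), ContDiff ℝ 1 G ∧
    (∀ z, fderiv ℝ S.F z = (G z).comp S.ι) ∧
    ∃ C q : ℝ, 1 ≤ q ∧ ∀ z v, ‖fderiv ℝ G z v‖ ≤ C * (1 + ‖z‖ ^ q) * ‖v‖
  -- `I(t,·)` is of class `C^{2,1}_loc`
  energy_C21 : ∀ t ∈ Icc (0 : ℝ) S.T, ∀ r : ℝ, 0 < r → ∃ C : ℝ, 0 ≤ C ∧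
    ∀ z₁ ∈ Metric.ball (0 : Z) r, ∀ z₂ ∈ Metric.ball (0 : Z) r, ∀ v : Z,
      (S.d2Energy t z₁ - S.d2Energy t z₂) v v ≤ C * ‖z₁ - z₂‖ * ‖v‖ ^ 2
  -- the dissipation potential
  R_nonneg : ∀ v, 0 ≤ S.R v
  R_lsc : LowerSemicontinuous S.R
  R_convex : ConvexOn ℝ univ S.R
  R_homogeneous : ∀ c : ℝ, 0 < c → ∀ v, S.R (c • v) = c * S.R v
  R_bounds : ∃ ρ₁ ρ₂ : ℝ, 0 < ρ₁ ∧ 0 < ρ₂ ∧ ∀ v, ρ₁ * ‖S.j v‖ ≤ S.R v ∧ S.R v ≤ ρ₂ * ‖v‖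
  -- local stability of the initial state
  z₀_stable : -S.dEnergy 0 S.z₀ ∈ subdifferential S.dissipation 0

/-- `z ∈ W^{1,1}(0,T;Z)` is a differential solution:
`z(0) = z₀` and `0 ∈ ∂R(z'(t)) + D_z I(t,z(t))` for almost all `t ∈ [0,T]`. -/
def System.IsDifferentialSolution (S : System Z V X) (z : ℝ → Z) : Prop :=
  z 0 = S.z₀ ∧ ∃ z' : ℝ → Z, HasW11Deriv S.T z z' ∧
    ∀ᵐ t ∂(volume.restrict (Icc (0 : ℝ) S.T)),
      -S.dEnergy t (z t) ∈ subdifferential S.dissipation (z' t)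

/-- Local `κ`-uniform convexity of the energy around `z`, with radius `Δ`. -/
def System.LocallyUniformlyConvex (S : System Z V X) (z : ℝ → Z) (κ Δ : ℝ) : Prop :=
  0 < κ ∧ 0 < Δ ∧ ∀ t ∈ Icc (0 : ℝ) S.T, ∀ y ∈ Metric.closedBall (z t) Δ, ∀ v : Z,
    κ * ‖v‖ ^ 2 ≤ S.d2Energy t y v v

/-- `(t_k, z_k)` are iterates of the local incremental minimization scheme with parameter `τ`
(the iteration is simply continued once the final time is reached). -/
structure System.IsLocalMinScheme (S : System Z V X) (τ : ℝ) (t : ℕ → ℝ) (z : ℕ → Z) : Prop where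
  t_zero : t 0 = 0
  z_zero : z 0 = S.z₀
  step_le : ∀ k, ‖S.ι (z (k + 1) - z k)‖ ≤ τ
  isMinOn : ∀ k, IsMinOn (fun y => S.energy (t k) y + S.R (S.ι (y - z k)))
    {y | ‖S.ι (y - z k)‖ ≤ τ} (z (k + 1))
  t_succ : ∀ k, t (k + 1) = min (t k + τ - ‖S.ι (z (k + 1) - z k)‖) S.T

/-- The continuous piecewise affine interpolant, in the artificial time, of a sequence `u`
with nodes `s_k = k τ`. -/
noncomputable def affineInterpolant {E : Type*} [AddCommGroup E] [Module ℝ E]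
    (τ : ℝ) (u : ℕ → E) (s : ℝ) : E :=
  u ⌊s / τ⌋₊ + (s / τ - ⌊s / τ⌋₊) • (u (⌊s / τ⌋₊ + 1) - u ⌊s / τ⌋₊)

/-- `N(τ)`: the number of iterations after which the final time `T` is reached. -/
noncomputable def stepCount (T : ℝ) (t : ℕ → ℝ) : ℕ := sInf {k | t k = T}

/-- The end `S_τ = N(τ) τ` of the artificial time interval. -/
noncomputable def artificialEnd (T τ : ℝ) (t : ℕ → ℝ) : ℝ := stepCount T t * τ

/-- The back-transformed discrete solution `z_τ = ẑ_τ ∘ s_τ`, where `s_τ : [0,T] → [0,S_τ]` is the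
inverse of the interpolant `t̂_τ`; meaningful when `t̂_τ` maps `[0,S_τ]` bijectively
onto `[0,T]`. -/
noncomputable def backTransformed {E : Type*} [AddCommGroup E] [Module ℝ E]
    (T τ : ℝ) (t : ℕ → ℝ) (z : ℕ → E) (x : ℝ) : E :=
  affineInterpolant τ z
    (Function.invFunOn (affineInterpolant τ t) (Icc 0 (artificialEnd T τ t)) x)

end LocalMin

/-! The iterate `y (k + 1)` minimizes with the load frozen at `t k`. If its constraint is inactive,
the shifted sequence `w k = y (k + 1)` therefore consists of implicit Euler steps on the variable
grid `t k`. Initial stability and convexity give `y 1 = y 0`, so this sequence starts at `z₀`.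

Inactivity follows from convexity: comparing a minimizer with its stable predecessor gives `κ ‖y (k
+ 1) - y k‖ ≤ L (t k - t (k - 1)) ≤ L τ < κ τ` (`mul_norm_sub_le`). The strict gap also makes each
time increment at least `(1 - L / κ) τ` until `T` is reached. Using convexity requires the minimizer
to lie near `z` beforehand; this comes from the coercivity of `A` and from `F` being Lipschitz in
the `V`-norm on bounded sets (`exists_norm_sub_le`).

For the Euler steps, the Bregman distance between the affine interpolant and `z` is differentiated
in time (`bregman_step`). Stability and the flow rules leave the dissipation increments `(ξ (k + 1)
- ξ k) (w (k + 1) - w k)`, with `ξ k = l (t k) - Df (w k)`, besides a Gronwall term and errors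
summing to order `τ²`. Each increment is of order `τ²`, which alone would give only rate one half.
But the increment is `O(τ²)` times the decrease of a quadratic potential of the discrete velocity,
up to the oscillation of `D²f` and of `ℓ'` (`increment_le_potential`). The sum telescopes because
`ℓ'` has bounded variation, so the total is `O(τ²)` and the error is `O(τ)`, since the Bregman
distance dominates the squared norm.

The error constant does not depend on the number of steps, so an induction over the steps keeps the
scheme in the region of convexity (`exists_goodStep`). -/

namespace LocalMin

/-! ### Calculus -/

/-- A Lipschitz function whose derivative is almost everywhere at most `H` grows at most
with slope `H`. -/
theorem sub_le_of_ae_hasDerivAt_le {f : ℝ → ℝ} {a b H : ℝ} {K : ℝ≥0} (hab : a ≤ b)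
    (hf : LipschitzOnWith K f (Icc a b))
    (hd : ∀ᵐ x, x ∈ Ioo a b → ∃ d ≤ H, HasDerivAt f d x) : f b - f a ≤ H * (b - a) := by
  -- Absolute continuity makes the increment the integral of the almost everywhere derivative; a
  -- Lipschitz solution offers no more differentiability than that.
  have hac : AbsolutelyContinuousOnInterval f a b :=
    LipschitzOnWith.absolutelyContinuousOnInterval (by rwa [uIcc_of_le hab])
  rw [← hac.integral_deriv_eq_sub]
  have h1 : ∫ x in a..b, deriv f x ≤ ∫ x in a..b, H := by
    refine intervalIntegral.integral_mono_ae_restrict hab hac.intervalIntegrable_deriv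
      intervalIntegrable_const ?_
    have h2 : (∀ᵐ x : ℝ, x ≠ a) ∧ ∀ᵐ x : ℝ, x ≠ b := by
      constructor <;> simp [ae_iff, measure_singleton]
    rw [Filter.EventuallyLE, ae_restrict_iff' measurableSet_Icc]
    filter_upwards [hd, h2.1, h2.2] with x hx hxa hxb hxI
    obtain ⟨d, hdH, hd⟩ := hx ⟨lt_of_le_of_ne hxI.1 (Ne.symm hxa), lt_of_le_of_ne hxI.2 hxb⟩
    rw [hd.deriv]; exact hdH
  refine h1.trans (le_of_eq ?_)
  rw [intervalIntegral.integral_const, smul_eq_mul]; ring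

/-! ### Second order estimates for functions of class C². -/

section SecondOrder

variable {E : Type*} [NormedAddCommGroup E] [NormedSpace ℝ E] {f : E → ℝ} {C r κ : ℝ}

/-- Polarization: `4 B u v` is the difference of the form at `u + v` and at `u - v`, each at most `4
c` in modulus for unit vectors. -/
theorem norm_le_of_forall_apply_self_le {B : E →L[ℝ] (E →L[ℝ] ℝ)} {c : ℝ} (hc : 0 ≤ c)
    (hs : ∀ u v, B u v = B v u) (hB : ∀ v, |B v v| ≤ c * ‖v‖ ^ 2) : ‖B‖ ≤ 2 * c := by
  refine ContinuousLinearMap.opNorm_le_of_unit_norm (by positivity) fun u hu => ?_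
  refine ContinuousLinearMap.opNorm_le_of_unit_norm (by positivity) fun v hv => ?_
  have h1 := abs_le.1 (hB (u + v))
  have h2 := abs_le.1 (hB (u - v))
  have h3 : ‖u + v‖ ≤ 2 := (norm_add_le _ _).trans (by rw [hu, hv]; norm_num)
  have h4 : ‖u - v‖ ≤ 2 := (norm_sub_le _ _).trans (by rw [hu, hv]; norm_num)
  have h5 : c * ‖u + v‖ ^ 2 ≤ c * 4 := by
    gcongr; nlinarith [norm_nonneg (u + v)]
  have h6 : c * ‖u - v‖ ^ 2 ≤ c * 4 := by
    gcongr; nlinarith [norm_nonneg (u - v)]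
  simp only [map_add, map_sub, add_apply, sub_apply] at h1 h2
  rw [hs v u] at h1 h2
  rw [Real.norm_eq_abs, abs_le]
  constructor <;> linarith

theorem apply_le_mul_of_norm_le {φ : E →L[ℝ] ℝ} {u : E} {c d : ℝ} (hφ : ‖φ‖ ≤ c) (hu : ‖u‖ ≤ d) :
    φ u ≤ c * d :=
  (le_abs_self _).trans ((φ.le_opNorm u).trans
    (mul_le_mul hφ hu (norm_nonneg _) ((norm_nonneg _).trans hφ)))

theorem fderiv_fderiv_comm (hf : ContDiff ℝ 2 f) (x u v : E) :
    fderiv ℝ (fderiv ℝ f) x u v = fderiv ℝ (fderiv ℝ f) x v u :=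
  (hf.contDiffAt.isSymmSndFDerivAt (by simp)).eq u v

theorem contDiff_fderiv (hf : ContDiff ℝ 2 f) : ContDiff ℝ 1 (fderiv ℝ f) :=
  hf.fderiv_right (by norm_num)

theorem hasFDerivAt_fderiv (hf : ContDiff ℝ 2 f) (x : E) :
    HasFDerivAt (fderiv ℝ f) (fderiv ℝ (fderiv ℝ f) x) x :=
  ((contDiff_fderiv hf).differentiable (by norm_num) x).hasFDerivAt

theorem norm_sub_le_of_mem_segment {x y p : E} (hp : p ∈ segment ℝ x y) : ‖p - x‖ ≤ ‖y - x‖ := by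
  rw [segment_eq_image'] at hp
  obtain ⟨θ, ⟨h0, h1⟩, rfl⟩ := hp
  simp only [add_sub_cancel_left, norm_smul, Real.norm_eq_abs, abs_of_nonneg h0]
  exact mul_le_of_le_one_left (norm_nonneg _) h1

/-- Second order Taylor estimate for the gradient. -/
theorem norm_fderiv_sub_sub_le (hf : ContDiff ℝ 2 f) (hC0 : 0 ≤ C)
    (hC : ∀ x ∈ Metric.ball (0 : E) r, ∀ y ∈ Metric.ball (0 : E) r,
      ‖fderiv ℝ (fderiv ℝ f) x - fderiv ℝ (fderiv ℝ f) y‖ ≤ C * ‖x - y‖)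
    {x y : E} (hx : x ∈ Metric.ball (0 : E) r) (hy : y ∈ Metric.ball (0 : E) r) :
    ‖fderiv ℝ f y - fderiv ℝ f x - fderiv ℝ (fderiv ℝ f) x (y - x)‖ ≤ C * ‖y - x‖ ^ 2 := by
  have h := (convex_segment (𝕜 := ℝ) x y).norm_image_sub_le_of_norm_hasFDerivWithin_le'
    (f := fderiv ℝ f) (f' := fderiv ℝ (fderiv ℝ f)) (φ := fderiv ℝ (fderiv ℝ f) x)
    (C := C * ‖y - x‖) (x := x) (y := y)
    (fun p _ => (hasFDerivAt_fderiv hf p).hasFDerivWithinAt) (fun p hp => ?_)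
    (left_mem_segment ℝ x y) (right_mem_segment ℝ x y)
  · rw [pow_two, ← mul_assoc]; exact h
  · exact (hC p ((convex_ball _ _).segment_subset hx hy hp) x hx).trans
      (by gcongr; exact norm_sub_le_of_mem_segment hp)

/-- Error of the affine interpolation of the gradient. -/
theorem norm_fderiv_interpolate_le (hf : ContDiff ℝ 2 f) (hC0 : 0 ≤ C)
    (hC : ∀ x ∈ Metric.ball (0 : E) r, ∀ y ∈ Metric.ball (0 : E) r,
      ‖fderiv ℝ (fderiv ℝ f) x - fderiv ℝ (fderiv ℝ f) y‖ ≤ C * ‖x - y‖)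
    {x y : E} (hx : x ∈ Metric.ball (0 : E) r) (hy : y ∈ Metric.ball (0 : E) r)
    {θ : ℝ} (hθ0 : 0 ≤ θ) (hθ1 : θ ≤ 1) :
    ‖fderiv ℝ f (x + θ • (y - x)) - fderiv ℝ f x - θ • (fderiv ℝ f y - fderiv ℝ f x)‖
      ≤ 2 * C * ‖y - x‖ ^ 2 := by
  have hp : x + θ • (y - x) ∈ segment ℝ x y := by
    rw [segment_eq_image']; exact ⟨θ, ⟨hθ0, hθ1⟩, rfl⟩
  have h1 := norm_fderiv_sub_sub_le hf hC0 hC hx ((convex_ball _ _).segment_subset hx hy hp)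
  have h2 := norm_fderiv_sub_sub_le hf hC0 hC hx hy
  have h3 := norm_sub_le_of_mem_segment hp
  simp only [add_sub_cancel_left] at h1 h3
  set P := fderiv ℝ f (x + θ • (y - x)) - fderiv ℝ f x
  set Q := fderiv ℝ f y - fderiv ℝ f x
  set M := fderiv ℝ (fderiv ℝ f) x
  -- The linear part `M` cancels exactly and leaves two Taylor remainders at `x`.
  have h4 : P - θ • Q = (P - M (θ • (y - x))) - θ • (Q - M (y - x)) := by
    rw [show M (θ • (y - x)) = θ • M (y - x) from map_smul _ _ _,
      smul_sub θ Q]; abel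
  rw [h4]
  refine (norm_sub_le _ _).trans ?_
  have h5 : ‖θ • (Q - M (y - x))‖ ≤ C * ‖y - x‖ ^ 2 := by
    rw [norm_smul, Real.norm_eq_abs, abs_of_nonneg hθ0]
    exact (mul_le_of_le_one_left (norm_nonneg _) hθ1).trans h2
  have h6 : C * ‖θ • (y - x)‖ ^ 2 ≤ C * ‖y - x‖ ^ 2 := by gcongr
  linarith

theorem hasDerivAt_segment (x d : E) (s : ℝ) : HasDerivAt (fun s : ℝ => x + s • d) d s := by
  simpa using ((hasDerivAt_id s).smul_const d).const_add x

/-- Strong monotonicity of the gradient along a segment of uniform convexity. -/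
theorem mul_sq_le_fderiv_sub_apply (hf : ContDiff ℝ 2 f) {x y : E}
    (hκ : ∀ p ∈ segment ℝ x y, ∀ v, κ * ‖v‖ ^ 2 ≤ fderiv ℝ (fderiv ℝ f) p v v) :
    κ * ‖y - x‖ ^ 2 ≤ (fderiv ℝ f y - fderiv ℝ f x) (y - x) := by
  have hd : ∀ s : ℝ, HasDerivAt (fun s : ℝ => fderiv ℝ f (x + s • (y - x)) (y - x))
      (fderiv ℝ (fderiv ℝ f) (x + s • (y - x)) (y - x) (y - x)) s := fun s =>
    (((hasFDerivAt_fderiv hf _).comp_hasDerivAt s (hasDerivAt_segment x (y - x) s)).clm_apply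
      (hasDerivAt_const s (y - x))).congr_deriv (by simp)
  obtain ⟨c, hc, h⟩ := exists_hasDerivAt_eq_slope _ _ (zero_lt_one' ℝ)
    (fun s _ => (hd s).continuousAt.continuousWithinAt) (fun s _ => hd s)
  have h2 := hκ (x + c • (y - x)) (by
    rw [segment_eq_image']; exact ⟨c, ⟨hc.1.le, hc.2.le⟩, rfl⟩) (y - x)
  rw [h] at h2
  simpa using h2

/-- Lower bound of the Bregman distance along a segment of uniform convexity. -/
theorem mul_sq_le_bregman (hf : ContDiff ℝ 2 f) {x y : E}
    (hκ : ∀ p ∈ segment ℝ x y, ∀ v, κ * ‖v‖ ^ 2 ≤ fderiv ℝ (fderiv ℝ f) p v v) :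
    κ / 2 * ‖y - x‖ ^ 2 ≤ f y - f x - fderiv ℝ f x (y - x) := by
  have hd : ∀ s : ℝ, HasDerivAt (fun s : ℝ => f (x + s • (y - x)) - s * fderiv ℝ f x (y - x)
        - κ / 2 * ‖y - x‖ ^ 2 * s ^ 2)
      (fderiv ℝ f (x + s • (y - x)) (y - x) - fderiv ℝ f x (y - x)
        - κ * ‖y - x‖ ^ 2 * s) s := fun s => by
    have h1 := ((hf.differentiable (by norm_num) (x + s • (y - x))).hasFDerivAt).comp_hasDerivAt s
      (hasDerivAt_segment x (y - x) s)
    have h2 := (hasDerivAt_id s).mul_const (fderiv ℝ f x (y - x))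
    have h3 := (hasDerivAt_pow 2 s).const_mul (κ / 2 * ‖y - x‖ ^ 2)
    refine ((h1.sub h2).sub h3).congr_deriv ?_
    simp; ring
  -- The derivative of this function is nonnegative by strong monotonicity on the shorter segment
  -- from `x` to `x + s • (y - x)`; its values at 0 and 1 give the claim.
  have hmono : MonotoneOn (fun s : ℝ => f (x + s • (y - x)) - s * fderiv ℝ f x (y - x)
        - κ / 2 * ‖y - x‖ ^ 2 * s ^ 2) (Icc 0 1) := by
    refine monotoneOn_of_deriv_nonneg (convex_Icc 0 1)
      (fun s _ => (hd s).continuousAt.continuousWithinAt)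
      (fun s _ => (hd s).differentiableAt.differentiableWithinAt) fun s hs => ?_
    rw [interior_Icc] at hs
    rw [(hd s).deriv]
    have hsub : segment ℝ x (x + s • (y - x)) ⊆ segment ℝ x y :=
      (convex_segment x y).segment_subset (left_mem_segment ℝ x y) (by
        rw [segment_eq_image']; exact ⟨s, ⟨hs.1.le, hs.2.le⟩, rfl⟩)
    have h1 := mul_sq_le_fderiv_sub_apply hf fun p hp => hκ p (hsub hp)
    simp only [add_sub_cancel_left, norm_smul, Real.norm_eq_abs, abs_of_pos hs.1, map_smul,
      sub_apply, smul_eq_mul] at h1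
    have h2 : 0 ≤ s * (fderiv ℝ f (x + s • (y - x)) (y - x) - fderiv ℝ f x (y - x)
        - κ * ‖y - x‖ ^ 2 * s) := by nlinarith
    exact nonneg_of_mul_nonneg_right h2 hs.1
  have h := hmono (left_mem_Icc.2 zero_le_one) (right_mem_Icc.2 zero_le_one) zero_le_one
  simp at h
  rw [map_sub]; linarith

end SecondOrder

/-! ### Subdifferentials of positively homogeneous functionals -/

/-- Testing with `0` and `2 u` forces equality at `u`. This splits the inclusion into a flow rule
and a stability condition, the only two forms used below. -/
theorem mem_subdifferential_iff {E : Type*} [NormedAddCommGroup E] [NormedSpace ℝ E]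
    {J : E → ℝ} (h0 : J 0 = 0) (hJ : ∀ c : ℝ, 0 < c → ∀ v, J (c • v) = c * J v)
    {u : E} {ξ : E →L[ℝ] ℝ} :
    ξ ∈ subdifferential J u ↔ J u = ξ u ∧ ∀ w, ξ w ≤ J w := by
  simp only [subdifferential, mem_ofPred_eq]
  constructor
  · intro h
    have h1 : J u = ξ u := by
      have ha := h 0
      have hb := h ((2 : ℝ) • u)
      rw [hJ 2 two_pos] at hb
      simp [h0] at ha hb
      linarith
    refine ⟨h1, fun w => ?_⟩
    have := h w
    rw [map_sub] at this; linarith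
  · rintro ⟨h1, h2⟩ w
    rw [map_sub, h1]; linarith [h2 w]

/-! ### Functions with a derivative of bounded variation -/

/-- If `u'` is of bounded variation, its primitive `u` is approximated by its tangents up to the
increments of a monotone function. -/
theorem HasBVDeriv.exists_monotone {E : Type*} [NormedAddCommGroup E] [NormedSpace ℝ E]
    [CompleteSpace E] {T : ℝ} (hT : 0 ≤ T) {u : ℝ → E} (hu : HasBVDeriv T u) :
    ∃ (g : ℝ → E) (v : ℝ → ℝ), MonotoneOn v (Icc 0 T) ∧
      (∀ a ∈ Icc 0 T, ∀ b ∈ Icc 0 T, a ≤ b → ‖g b - g a‖ ≤ v b - v a) ∧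
      ∀ a ∈ Icc 0 T, ∀ b ∈ Icc 0 T, a ≤ b →
        ‖u b - u a - (b - a) • g a‖ ≤ (v b - v a) * (b - a) := by
  obtain ⟨g, ⟨hint, hprim⟩, hbv⟩ := hu
  have h0 : (0 : ℝ) ∈ Icc 0 T := ⟨le_rfl, hT⟩
  have hloc := hbv.locallyBoundedVariationOn
  have hg : ∀ a ∈ Icc 0 T, ∀ b ∈ Icc 0 T, a ≤ b →
      ‖g b - g a‖ ≤ variationOnFromTo g (Icc 0 T) 0 b - variationOnFromTo g (Icc 0 T) 0 a := by
    intro a ha b hb hab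
    rw [variationOnFromTo.sub_right hloc h0 hb ha, variationOnFromTo.eq_of_le _ _ hab,
      ← dist_eq_norm, dist_edist, edist_comm]
    refine ENNReal.toReal_mono (hloc a b ha hb) ?_
    exact eVariationOn.edist_le g ⟨ha, ⟨le_rfl, hab⟩⟩ ⟨hb, ⟨hab, le_rfl⟩⟩
  refine ⟨g, variationOnFromTo g (Icc 0 T) 0, variationOnFromTo.monotoneOn hloc h0, hg, ?_⟩
  intro a ha b hb hab
  have hia : IntervalIntegrable g volume 0 a :=
    hint.mono_set (by rw [uIcc_of_le ha.1, uIcc_of_le hT]; exact Icc_subset_Icc_right ha.2)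
  have hib : IntervalIntegrable g volume 0 b :=
    hint.mono_set (by rw [uIcc_of_le hb.1, uIcc_of_le hT]; exact Icc_subset_Icc_right hb.2)
  have hab' : IntervalIntegrable g volume a b := hia.symm.trans hib
  have h1 : u b - u a - (b - a) • g a = ∫ s in a..b, (g s - g a) := by
    rw [intervalIntegral.integral_sub hab' intervalIntegrable_const,
      intervalIntegral.integral_const, hprim a ha, hprim b hb,
      ← intervalIntegral.integral_add_adjacent_intervals hia hab']
    abel
  rw [h1]
  refine (intervalIntegral.norm_integral_le_of_norm_le_const fun s hs => ?_).trans
    (le_of_eq (by rw [abs_of_nonneg (sub_nonneg.2 hab)]))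
  rw [uIoc_of_le hab] at hs
  have hs' : s ∈ Icc 0 T := ⟨ha.1.trans hs.1.le, hs.2.trans hb.2⟩
  have h2 := variationOnFromTo.monotoneOn hloc h0 hs' hb hs.2
  linarith [hg a ha s hs' hs.1.le]

/-- The primitive `u` of `u'` has derivative `u'` almost everywhere. -/
theorem HasW11Deriv.ae_hasDerivAt {E : Type*} [NormedAddCommGroup E] [NormedSpace ℝ E]
    [CompleteSpace E] {T : ℝ} (hT : 0 ≤ T) {u u' : ℝ → E} (hu : HasW11Deriv T u u') :
    ∀ᵐ t, t ∈ Ioo 0 T → HasDerivAt u (u' t) t := by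
  filter_upwards [hu.1.ae_hasDerivAt_integral] with t ht htI
  rw [uIcc_of_le hT] at ht
  have h1 := (ht (Ioo_subset_Icc_self htI) 0 ⟨le_rfl, hT⟩).const_add (u 0)
  refine h1.congr_of_eventuallyEq ?_
  filter_upwards [Ioo_mem_nhds htI.1 htI.2] with s hs
  exact hu.2 s (Ioo_subset_Icc_self hs)

/-! ### Error estimate for implicit Euler steps -/

/-- Quantitative form of the assumptions on a rate-independent evolution `z` driven by the
energy `f - l(t)` and the dissipation `ψ`. -/
structure Evolution {Z : Type*} [NormedAddCommGroup Z] [NormedSpace ℝ Z]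
    (f ψ : Z → ℝ) (l : ℝ → Z →L[ℝ] ℝ) (z : ℝ → Z) (T κ Δ r C M : ℝ) (Λ : ℝ≥0)
    (g : ℝ → Z →L[ℝ] ℝ) (v : ℝ → ℝ) : Prop where
  T_pos : 0 < T
  κ_pos : 0 < κ
  Δ_pos : 0 < Δ
  C_nonneg : 0 ≤ C
  contDiff : ContDiff ℝ 2 f
  lipschitz_second : ∀ x ∈ Metric.ball (0 : Z) r, ∀ y ∈ Metric.ball (0 : Z) r,
    ‖fderiv ℝ (fderiv ℝ f) x - fderiv ℝ (fderiv ℝ f) y‖ ≤ C * ‖x - y‖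
  bound_second : ∀ x ∈ Metric.ball (0 : Z) r, ‖fderiv ℝ (fderiv ℝ f) x‖ ≤ M
  convex : ∀ t ∈ Icc 0 T, ∀ y ∈ Metric.closedBall (z t) Δ, ∀ w,
    κ * ‖w‖ ^ 2 ≤ fderiv ℝ (fderiv ℝ f) y w w
  ball_subset : ∀ t ∈ Icc 0 T, Metric.closedBall (z t) Δ ⊆ Metric.ball 0 r
  lipschitz : LipschitzOnWith Λ z (Icc 0 T)
  ψ_homogeneous : ∀ c : ℝ, 0 < c → ∀ w, ψ (c • w) = c * ψ w
  solution : ∀ᵐ t, t ∈ Ioo 0 T → ∃ z', HasDerivAt z z' t ∧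
    ψ z' = (l t - fderiv ℝ f (z t)) z' ∧ ∀ w, (l t - fderiv ℝ f (z t)) w ≤ ψ w
  load_lipschitz : ∀ s ∈ Icc 0 T, ∀ t ∈ Icc 0 T, ‖l t - l s‖ ≤ Λ * |t - s|
  v_mono : MonotoneOn v (Icc 0 T)
  g_sub : ∀ a ∈ Icc 0 T, ∀ b ∈ Icc 0 T, a ≤ b → ‖g b - g a‖ ≤ v b - v a
  load_sub : ∀ a ∈ Icc 0 T, ∀ b ∈ Icc 0 T, a ≤ b →
    ‖l b - l a - (b - a) • g a‖ ≤ (v b - v a) * (b - a)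

/-- The Bregman distance of `f`. -/
noncomputable def bregman {Z : Type*} [NormedAddCommGroup Z] [NormedSpace ℝ Z]
    (f : Z → ℝ) (y x : Z) : ℝ := f y - f x - fderiv ℝ f x (y - x)

namespace Evolution

variable {Z : Type*} [NormedAddCommGroup Z] [NormedSpace ℝ Z]
    {f ψ : Z → ℝ} {l : ℝ → Z →L[ℝ] ℝ} {z : ℝ → Z} {T κ Δ r C M : ℝ} {Λ : ℝ≥0}
    {g : ℝ → Z →L[ℝ] ℝ} {v : ℝ → ℝ}

theorem mem_ball (S : Evolution f ψ l z T κ Δ r C M Λ g v) {t : ℝ} (ht : t ∈ Icc 0 T) :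
    z t ∈ Metric.ball (0 : Z) r :=
  S.ball_subset t ht (Metric.mem_closedBall_self S.Δ_pos.le)

theorem norm_sub_le (S : Evolution f ψ l z T κ Δ r C M Λ g v) {s t : ℝ} (hs : s ∈ Icc 0 T)
    (ht : t ∈ Icc 0 T) : ‖z t - z s‖ ≤ Λ * |t - s| := by
  simpa [dist_eq_norm, Real.dist_eq] using S.lipschitz.dist_le_mul t ht s hs

theorem M_nonneg (S : Evolution f ψ l z T κ Δ r C M Λ g v) : 0 ≤ M :=
  (norm_nonneg (fderiv ℝ (fderiv ℝ f) (z 0))).trans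
    (S.bound_second _ (S.mem_ball ⟨le_rfl, S.T_pos.le⟩))

/-- The affine interpolant of the load is close to the load. -/
theorem norm_interpolate_load_sub_le (S : Evolution f ψ l z T κ Δ r C M Λ g v) {a b t : ℝ}
    (ha : a ∈ Icc 0 T) (hb : b ∈ Icc 0 T) (hat : a < t) (htb : t < b) :
    ‖l a + ((t - a) / (b - a)) • (l b - l a) - l t‖ ≤ 2 * (v b - v a) * (b - a) := by
  have hh : 0 < b - a := by linarith
  have ht : t ∈ Icc 0 T := ⟨ha.1.trans hat.le, htb.le.trans hb.2⟩
  have h1 := S.load_sub a ha t ht hat.le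
  have h2 := S.load_sub a ha b hb (hat.trans htb).le
  have hθ0 : 0 ≤ (t - a) / (b - a) := div_nonneg (by linarith) hh.le
  have hθ1 : (t - a) / (b - a) ≤ 1 := (div_le_one hh).2 (by linarith)
  have hv : v t - v a ≤ v b - v a := by linarith [S.v_mono ht hb htb.le]
  have hv0 : 0 ≤ v b - v a := by linarith [S.v_mono ha hb (hat.trans htb).le]
  -- Both brackets are tangent errors at `a`: the slope `g a` drops out since `(t - a) / (b - a) *
  -- (b - a) = t - a`.
  have h3 : l a + ((t - a) / (b - a)) • (l b - l a) - l t =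
      ((t - a) / (b - a)) • (l b - l a - (b - a) • g a) - (l t - l a - (t - a) • g a) := by
    rw [smul_sub _ (l b - l a), smul_smul, div_mul_cancel₀ _ hh.ne']; abel
  rw [h3]
  refine (_root_.norm_sub_le _ _).trans ?_
  have h4 : ‖((t - a) / (b - a)) • (l b - l a - (b - a) • g a)‖ ≤ (v b - v a) * (b - a) := by
    rw [norm_smul, Real.norm_eq_abs, abs_of_nonneg hθ0]
    exact (mul_le_of_le_one_left (norm_nonneg _) hθ1).trans h2
  have h5 : (v t - v a) * (t - a) ≤ (v b - v a) * (b - a) := by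
    apply mul_le_mul hv (by linarith) (by linarith) hv0
  linarith

/-- Growth of the Bregman distance between the Euler step from `x` to `y` and the solution. -/
theorem bregman_step (S : Evolution f ψ l z T κ Δ r C M Λ g v) {a b : ℝ} {x y : Z}
    (ha : a ∈ Icc 0 T) (hb : b ∈ Icc 0 T) (hab : a < b)
    (hx : x ∈ Metric.ball (0 : Z) r) (hy : y ∈ Metric.ball (0 : Z) r) (hd : ‖y - x‖ ≤ b - a)
    (hxs : ∀ w, (l a - fderiv ℝ f x) w ≤ ψ w) (hys : ∀ w, (l b - fderiv ℝ f y) w ≤ ψ w)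
    (hflow : ψ (y - x) = (l b - fderiv ℝ f y) (y - x)) :
    bregman f y (z b) ≤ bregman f x (z a)
      + ((l b - fderiv ℝ f y) - (l a - fderiv ℝ f x)) (y - x)
      + (b - a) * (2 * (1 + Λ) * (v b - v a) * (b - a) + 2 * C * (1 + Λ) * (b - a) ^ 2
        + C * Λ * (‖x - z a‖ + (1 + Λ) * (b - a)) ^ 2) := by
  set h := b - a with hh
  have h0 : 0 < h := by linarith
  set ξa := l a - fderiv ℝ f x with hξa
  set ξb := l b - fderiv ℝ f y with hξb
  set u := h⁻¹ • (y - x) with hu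
  have hu1 : ‖u‖ ≤ 1 := by
    rw [hu, norm_smul, norm_inv, Real.norm_eq_abs, abs_of_pos h0, inv_mul_le_iff₀ h0]; linarith
  have hψu : ψ u = ξb u := by
    rw [hu, S.ψ_homogeneous _ (inv_pos.2 h0), hflow, map_smul, smul_eq_mul]
  have hIcc : Icc a b ⊆ Icc 0 T := Icc_subset_Icc ha.1 hb.2
  set W : ℝ → Z := fun t => x + ((t - a) / h) • (y - x) with hW
  have hWd : ∀ t, HasDerivAt W u t := fun t => by
    have h1 := (((hasDerivAt_id t).sub_const a).div_const h).smul_const (y - x)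
    refine (h1.const_add x).congr_deriv ?_
    rw [hu, one_div]
  have hWa : W a = x := by simp [hW]
  have hWb : W b = y := by simp [hW, ← hh, h0.ne']
  -- The size of `K` is irrelevant; its existence permits integrating the almost everywhere
  -- derivative.
  obtain ⟨K, hK⟩ : ∃ K, LipschitzOnWith K (fun t => bregman f (W t) (z t)) (Icc a b) := by
    have hWc : ContDiff ℝ 1 W := by
      rw [hW]; fun_prop
    have hpair : LocallyLipschitz ((Icc a b).domRestrict fun t => (W t, z t)) :=
      LocallyLipschitz.prodMk
        (locallyLipschitzOn_iff_restrict.1 hWc.locallyLipschitz.locallyLipschitzOn)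
        (S.lipschitz.mono hIcc).to_restrict.locallyLipschitz
    have hB : ContDiff ℝ 1 fun p : Z × Z => bregman f p.1 p.2 := by
      have h1 := contDiff_fderiv S.contDiff
      have h2 : ContDiff ℝ 1 f := S.contDiff.of_le (by norm_num)
      unfold bregman
      exact ((h2.comp contDiff_fst).sub (h2.comp contDiff_snd)).sub
        ((h1.comp contDiff_snd).clm_apply (contDiff_fst.sub contDiff_snd))
    have hcomp : LocallyLipschitzOn (Icc a b) fun t => bregman f (W t) (z t) :=
      locallyLipschitzOn_iff_restrict.2 (hB.locallyLipschitz.comp hpair)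
    exact hcomp.exists_lipschitzOnWith_of_compact isCompact_Icc
  have hDnn : 0 ≤ (ξb - ξa) u := by
    rw [sub_apply, ← hψu]; linarith [hxs u]
  have key := sub_le_of_ae_hasDerivAt_le (H := (ξb - ξa) u + (2 * (1 + Λ) * (v b - v a) * h
      + 2 * C * (1 + Λ) * h ^ 2 + C * Λ * (‖x - z a‖ + (1 + Λ) * h) ^ 2)) hab.le hK ?_
  · rw [hWa, hWb, ← hh] at key
    have h1 : (ξb - ξa) u * h = (ξb - ξa) (y - x) := by
      rw [hu, map_smul, smul_eq_mul]; field_simp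
    nlinarith
  filter_upwards [S.solution] with t hsol htI
  obtain ⟨z', hz', hzflow, hzs⟩ := hsol ⟨ha.1.trans_lt htI.1, htI.2.trans_le hb.2⟩
  have htT : t ∈ Icc 0 T := hIcc (Ioo_subset_Icc_self htI)
  have hz'n : ‖z'‖ ≤ Λ := by
    have : Icc 0 T ∈ nhds t :=
      Icc_mem_nhds (ha.1.trans_lt htI.1) (htI.2.trans_le hb.2)
    exact hz'.le_of_lipschitzOn this S.lipschitz
  set θ := (t - a) / h with hθ
  have hθ0 : 0 ≤ θ := div_nonneg (by linarith [htI.1]) h0.le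
  have hθ1 : θ ≤ 1 := (div_le_one h0).2 (by linarith [htI.2])
  set e := W t - z t with he
  have hWt : W t = x + θ • (y - x) := rfl
  have hWball : W t ∈ Metric.ball (0 : Z) r := by
    refine (convex_ball _ _).segment_subset hx hy ?_
    rw [segment_eq_image']; exact ⟨θ, ⟨hθ0, hθ1⟩, rfl⟩
  have hen : ‖e‖ ≤ ‖x - z a‖ + (1 + Λ) * h := by
    have h1 : e = (x - z a) + θ • (y - x) - (z t - z a) := by rw [he, hWt]; abel
    have h2 : ‖θ • (y - x)‖ ≤ h := by
      rw [norm_smul, Real.norm_eq_abs, abs_of_nonneg hθ0]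
      exact (mul_le_of_le_one_left (norm_nonneg _) hθ1).trans hd
    have h3 : ‖z t - z a‖ ≤ Λ * h := by
      refine (S.norm_sub_le ha htT).trans ?_
      rw [abs_of_pos (by linarith [htI.1])]
      gcongr; linarith [htI.2]
    rw [h1]
    linarith [_root_.norm_sub_le (x - z a + θ • (y - x)) (z t - z a),
      norm_add_le (x - z a) (θ • (y - x))]
  refine ⟨_, ?_, (((S.contDiff.differentiable (by norm_num) (W t)).hasFDerivAt.comp_hasDerivAt t
    (hWd t)).sub ((S.contDiff.differentiable (by norm_num) (z t)).hasFDerivAt.comp_hasDerivAt t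
    hz')).sub (((hasFDerivAt_fderiv S.contDiff (z t)).comp_hasDerivAt t hz').clm_apply
    ((hWd t).sub hz'))⟩
  -- the four contributions to the derivative
  have t1 : (fderiv ℝ f (W t) - fderiv ℝ f x - θ • (fderiv ℝ f y - fderiv ℝ f x)) (u - z')
      ≤ 2 * C * h ^ 2 * (1 + Λ) := by
    have h1 := norm_fderiv_interpolate_le S.contDiff S.C_nonneg S.lipschitz_second hx hy hθ0 hθ1
    have h2 : 2 * C * ‖y - x‖ ^ 2 ≤ 2 * C * h ^ 2 := by
      have := S.C_nonneg; gcongr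
    exact apply_le_mul_of_norm_le (h1.trans h2)
      ((_root_.norm_sub_le _ _).trans (add_le_add hu1 hz'n))
  have t2 : (l a + θ • (l b - l a) - l t) (u - z') ≤ 2 * (v b - v a) * h * (1 + Λ) := by
    exact apply_le_mul_of_norm_le (S.norm_interpolate_load_sub_le ha hb htI.1 htI.2)
      ((_root_.norm_sub_le _ _).trans (add_le_add hu1 hz'n))
  -- Stability of the solution tested with `u`, and of both discrete states tested with `z'`,
  -- cancels the dissipation and leaves `(1 - θ) (ξb - ξa) u`.
  have t3 : ((l t - fderiv ℝ f (z t)) - (ξa + θ • (ξb - ξa))) (u - z') ≤ (ξb - ξa) u := by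
    have i1 := hzs u
    have i2 := mul_le_mul_of_nonneg_left (hxs z') (sub_nonneg.2 hθ1)
    have i3 := mul_le_mul_of_nonneg_left (hys z') hθ0
    have i4 := mul_nonneg hθ0 hDnn
    have i5 : ((l t - fderiv ℝ f (z t)) - (ξa + θ • (ξb - ξa))) (u - z') =
        (l t - fderiv ℝ f (z t)) u - (l t - fderiv ℝ f (z t)) z'
          - ((1 - θ) * ξa u + θ * ξb u) + ((1 - θ) * ξa z' + θ * ξb z') := by
      generalize l t - fderiv ℝ f (z t) = ξ
      simp only [sub_apply, add_apply, smul_apply, smul_eq_mul, map_sub]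
      ring
    rw [i5, ← hzflow]
    rw [show (ξb - ξa) u = ξb u - ξa u from rfl] at i4 ⊢
    linarith
  have t4 : (fderiv ℝ f (W t) - fderiv ℝ f (z t) - fderiv ℝ (fderiv ℝ f) (z t) e) z'
      ≤ C * Λ * (‖x - z a‖ + (1 + Λ) * h) ^ 2 := by
    have h1 := norm_fderiv_sub_sub_le S.contDiff S.C_nonneg S.lipschitz_second (S.mem_ball htT)
      hWball
    have hC := S.C_nonneg
    calc _ ≤ C * ‖e‖ ^ 2 * Λ := apply_le_mul_of_norm_le h1 hz'n
      _ ≤ C * (‖x - z a‖ + (1 + Λ) * h) ^ 2 * Λ := by gcongr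
      _ = _ := by ring
  -- Symmetry of `D²f` turns the term from differentiating the base point into the linear part of a
  -- Taylor remainder applied to `z'`, hence quadratic in `e`.
  have hcomm := fderiv_fderiv_comm S.contDiff (z t) z' e
  have hsum : ∀ φw φx φy φz : Z →L[ℝ] ℝ, φw u - φz z' - (fderiv ℝ (fderiv ℝ f) (z t) z' e
      + φz (u - z')) = (φw - φx - θ • (φy - φx)) (u - z')
      + (l a + θ • (l b - l a) - l t) (u - z')
      + ((l t - φz) - ((l a - φx) + θ • ((l b - φy) - (l a - φx)))) (u - z')
      + (φw - φz - fderiv ℝ (fderiv ℝ f) (z t) e) z' := fun φw φx φy φz => by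
    rw [hcomm]
    simp only [sub_apply, add_apply, smul_apply, smul_eq_mul, map_sub]
    ring
  refine (le_of_eq (hsum _ (fderiv ℝ f x) (fderiv ℝ f y) _)).trans ?_
  linarith

end Evolution

/-! ### Dissipation increments and discrete velocities. -/

/-- Potential of the discrete velocity `(y - x) / (b - a)` of an Euler step. -/
noncomputable def velocityPotential {Z : Type*} [NormedAddCommGroup Z] [NormedSpace ℝ Z]
    (f : Z → ℝ) (l : ℝ → Z →L[ℝ] ℝ) (a b : ℝ) (x y : Z) : ℝ :=
  1 / 2 * fderiv ℝ (fderiv ℝ f) x ((b - a)⁻¹ • (y - x)) ((b - a)⁻¹ • (y - x))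
    - ((b - a)⁻¹ • (l b - l a)) ((b - a)⁻¹ • (y - x))

namespace Evolution

variable {Z : Type*} [NormedAddCommGroup Z] [NormedSpace ℝ Z]
    {f ψ : Z → ℝ} {l : ℝ → Z →L[ℝ] ℝ} {z : ℝ → Z} {T κ Δ r C M : ℝ} {Λ : ℝ≥0}
    {g : ℝ → Z →L[ℝ] ℝ} {v : ℝ → ℝ}

theorem norm_slope_sub_le (S : Evolution f ψ l z T κ Δ r C M Λ g v) {a b : ℝ}
    (ha : a ∈ Icc 0 T) (hb : b ∈ Icc 0 T) (hab : a < b) :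
    ‖(b - a)⁻¹ • (l b - l a) - g a‖ ≤ v b - v a := by
  have h0 : 0 < b - a := sub_pos.2 hab
  have h1 : (b - a)⁻¹ • (l b - l a) - g a = (b - a)⁻¹ • (l b - l a - (b - a) • g a) := by
    rw [smul_sub _ (l b - l a), inv_smul_smul₀ h0.ne']
  rw [h1, norm_smul, norm_inv, Real.norm_eq_abs, abs_of_pos h0, inv_mul_le_iff₀ h0, mul_comm]
  exact S.load_sub a ha b hb hab.le

theorem norm_slope_le (S : Evolution f ψ l z T κ Δ r C M Λ g v) {a b : ℝ}
    (ha : a ∈ Icc 0 T) (hb : b ∈ Icc 0 T) (hab : a < b) :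
    ‖(b - a)⁻¹ • (l b - l a)‖ ≤ Λ := by
  have h0 : 0 < b - a := sub_pos.2 hab
  rw [norm_smul, norm_inv, Real.norm_eq_abs, abs_of_pos h0, inv_mul_le_iff₀ h0, mul_comm]
  simpa [abs_of_pos h0] using S.load_lipschitz a ha b hb

theorem norm_velocity_le {a b : ℝ} {x y : Z} (hab : a < b) (hd : ‖y - x‖ ≤ b - a) :
    ‖(b - a)⁻¹ • (y - x)‖ ≤ 1 := by
  have h0 : 0 < b - a := sub_pos.2 hab
  rw [norm_smul, norm_inv, Real.norm_eq_abs, abs_of_pos h0, inv_mul_le_iff₀ h0]; linarith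

/-- Needed at the two ends of the telescoping sum of potentials. -/
theorem abs_velocityPotential_le (S : Evolution f ψ l z T κ Δ r C M Λ g v) {a b : ℝ} {x y : Z}
    (ha : a ∈ Icc 0 T) (hb : b ∈ Icc 0 T) (hab : a < b) (hx : x ∈ Metric.ball (0 : Z) r)
    (hd : ‖y - x‖ ≤ b - a) : |velocityPotential f l a b x y| ≤ M + Λ := by
  have hu := norm_velocity_le hab hd
  have hM := S.M_nonneg
  rw [velocityPotential]
  set u := (b - a)⁻¹ • (y - x)
  have h1 : ‖fderiv ℝ (fderiv ℝ f) x u u‖ ≤ M := by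
    refine (ContinuousLinearMap.le_opNorm₂ _ _ _).trans ?_
    calc _ ≤ M * 1 * 1 := by gcongr; exact S.bound_second x hx
      _ = M := by ring
  have h2 : ‖((b - a)⁻¹ • (l b - l a)) u‖ ≤ Λ := by
    refine (ContinuousLinearMap.le_opNorm _ _).trans ?_
    calc _ ≤ (Λ : ℝ) * 1 := by gcongr; exact S.norm_slope_le ha hb hab
      _ = Λ := by ring
  rw [Real.norm_eq_abs, abs_le] at h1 h2
  rw [abs_le]
  constructor <;> linarith [h1.1, h1.2, h2.1, h2.2]

/-- The dissipation increment of the first step is quadratically small. -/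
theorem increment_le (S : Evolution f ψ l z T κ Δ r C M Λ g v) {a b : ℝ} {x y : Z}
    (ha : a ∈ Icc 0 T) (hb : b ∈ Icc 0 T) (hab : a < b)
    (hx : x ∈ Metric.ball (0 : Z) r) (hy : y ∈ Metric.ball (0 : Z) r) (hd : ‖y - x‖ ≤ b - a) :
    ((l b - fderiv ℝ f y) - (l a - fderiv ℝ f x)) (y - x) ≤ (Λ + M) * (b - a) ^ 2 := by
  have h1 : ‖fderiv ℝ f y - fderiv ℝ f x‖ ≤ M * ‖y - x‖ :=
    (convex_ball (0 : Z) r).norm_image_sub_le_of_norm_fderiv_le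
      (fun p _ => (hasFDerivAt_fderiv S.contDiff p).differentiableAt) S.bound_second hx hy
  have h2 := S.load_lipschitz a ha b hb
  rw [abs_of_pos (sub_pos.2 hab)] at h2
  have hM := S.M_nonneg
  have h3 : ‖(l b - fderiv ℝ f y) - (l a - fderiv ℝ f x)‖ ≤ (Λ + M) * (b - a) := by
    have : (l b - fderiv ℝ f y) - (l a - fderiv ℝ f x)
        = (l b - l a) - (fderiv ℝ f y - fderiv ℝ f x) := by abel
    rw [this]
    refine (_root_.norm_sub_le _ _).trans ?_
    have := mul_le_mul_of_nonneg_left hd hM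
    linarith
  exact (apply_le_mul_of_norm_le h3 hd).trans (le_of_eq (by ring))

/-- The dissipation increment of a step is controlled by the decrease of the velocity potential
and by the variation of the load. -/
theorem increment_le_potential (S : Evolution f ψ l z T κ Δ r C M Λ g v) {a b c τ : ℝ}
    {x₀ x₁ x₂ : Z} (ha : a ∈ Icc 0 T) (hb : b ∈ Icc 0 T) (hc : c ∈ Icc 0 T) (hab : a < b)
    (hbc : b < c) (hτ : c - b ≤ τ)
    (h₀ : x₀ ∈ Metric.ball (0 : Z) r) (h₁ : x₁ ∈ Metric.closedBall (z b) Δ)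
    (h₂ : x₂ ∈ Metric.ball (0 : Z) r) (hd₀ : ‖x₁ - x₀‖ ≤ b - a) (hd₁ : ‖x₂ - x₁‖ ≤ c - b)
    (hs₁ : ∀ w, (l b - fderiv ℝ f x₁) w ≤ ψ w) (hs₂ : ∀ w, (l c - fderiv ℝ f x₂) w ≤ ψ w)
    (hf₁ : ψ (x₁ - x₀) = (l b - fderiv ℝ f x₁) (x₁ - x₀))
    (hf₂ : ψ (x₂ - x₁) = (l c - fderiv ℝ f x₂) (x₂ - x₁)) :
    ((l c - fderiv ℝ f x₂) - (l b - fderiv ℝ f x₁)) (x₂ - x₁) ≤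
      τ ^ 2 * (velocityPotential f l a b x₀ x₁ - velocityPotential f l b c x₁ x₂
        + 2 * C * (c - b) + C * (b - a) + (v c - v b) + 2 * (v b - v a)) := by
  have hh₀ : 0 < b - a := sub_pos.2 hab
  have hh₁ : 0 < c - b := sub_pos.2 hbc
  have h₁' := S.ball_subset b hb h₁
  have hu₀ := norm_velocity_le hab hd₀
  have hu₁ := norm_velocity_le hbc hd₁
  have hm₀ := S.norm_slope_sub_le ha hb hab
  have hm₁ := S.norm_slope_sub_le hb hc hbc
  have hg := S.g_sub a ha b hb hab.le
  have htay := norm_fderiv_sub_sub_le S.contDiff S.C_nonneg S.lipschitz_second h₁' h₂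
  have hlip := S.lipschitz_second x₁ h₁' x₀ h₀
  have hC := S.C_nonneg
  unfold velocityPotential
  set u₀ := (b - a)⁻¹ • (x₁ - x₀) with hu₀d
  set u₁ := (c - b)⁻¹ • (x₂ - x₁) with hu₁d
  set m₀ := (b - a)⁻¹ • (l b - l a) with hm₀d
  set m₁ := (c - b)⁻¹ • (l c - l b) with hm₁d
  set M₀ := fderiv ℝ (fderiv ℝ f) x₀
  set M₁ := fderiv ℝ (fderiv ℝ f) x₁ with hM₁
  have ed₁ : x₂ - x₁ = (c - b) • u₁ := by rw [hu₁d, smul_inv_smul₀ hh₁.ne']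
  have em₁ : l c - l b = (c - b) • m₁ := by rw [hm₁d, smul_inv_smul₀ hh₁.ne']
  set ξ₁ := l b - fderiv ℝ f x₁ with hξ₁
  set ξ₂ := l c - fderiv ℝ f x₂ with hξ₂
  set ρ := fderiv ℝ f x₂ - fderiv ℝ f x₁ - M₁ (x₂ - x₁) with hρ
  have hξ : ξ₂ - ξ₁ = (c - b) • (m₁ - M₁ u₁) - ρ := by
    have e1 : M₁ (x₂ - x₁) = (c - b) • M₁ u₁ := by rw [ed₁, map_smul]
    rw [hρ, e1, smul_sub (c - b) m₁ (M₁ u₁), ← em₁, hξ₁, hξ₂]; abel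
  have hf₁' : ψ u₀ = ξ₁ u₀ := by
    rw [hu₀d, S.ψ_homogeneous _ (inv_pos.2 hh₀), hf₁, map_smul, smul_eq_mul]
  have hf₂' : ψ u₁ = ξ₂ u₁ := by
    rw [hu₁d, S.ψ_homogeneous _ (inv_pos.2 hh₁), hf₂, map_smul, smul_eq_mul]
  have hD0 : 0 ≤ (ξ₂ - ξ₁) u₁ := by
    rw [sub_apply, ← hf₂']; linarith [hs₁ u₁]
  -- The previous velocity may be subtracted for free: `ξ₁ u₀ = ψ u₀ ≥ ξ₂ u₀` by the flow rule of
  -- the first step and stability after the second.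
  have hDle : (ξ₂ - ξ₁) u₁ ≤ (ξ₂ - ξ₁) (u₁ - u₀) := by
    rw [map_sub]
    have : (ξ₂ - ξ₁) u₀ ≤ 0 := by
      rw [sub_apply, ← hf₁']; linarith [hs₂ u₀]
    linarith
  have hsub : ‖u₁ - u₀‖ ≤ 2 := (_root_.norm_sub_le _ _).trans (by linarith)
  have hρle : (-ρ) (u₁ - u₀) ≤ C * (c - b) ^ 2 * 2 := by
    refine apply_le_mul_of_norm_le ?_ hsub
    rw [norm_neg]
    exact htay.trans (by gcongr)
  have hquad : (m₁ - M₁ u₁) (u₁ - u₀) ≤ (1 / 2 * M₀ u₀ u₀ - m₀ u₀) - (1 / 2 * M₁ u₁ u₁ - m₁ u₁)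
      + C * (b - a) + (v c - v b) + 2 * (v b - v a) := by
    -- Convexity of the quadratic potential with frozen `M₁`, `m₁` bounds its gradient term by a
    -- difference of values; `q3` and `q4` pay for passing to `M₀`, `m₀` in the earlier one.
    have q1 : 0 ≤ M₁ (u₁ - u₀) (u₁ - u₀) :=
      (mul_nonneg S.κ_pos.le (sq_nonneg _)).trans (S.convex b hb x₁ h₁ (u₁ - u₀))
    have q2 : M₁ u₁ u₀ = M₁ u₀ u₁ := fderiv_fderiv_comm S.contDiff x₁ u₁ u₀
    have q3 : (M₁ - M₀) u₀ u₀ ≤ C * (b - a) := by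
      have : ‖(M₁ - M₀) u₀‖ ≤ C * (b - a) := by
        refine (ContinuousLinearMap.le_opNorm _ _).trans ?_
        calc _ ≤ C * (b - a) * 1 := by gcongr; exact hlip.trans (by gcongr)
          _ = _ := by ring
      exact (apply_le_mul_of_norm_le this hu₀).trans (by linarith)
    have q4 : (m₀ - m₁) u₀ ≤ (v c - v b) + 2 * (v b - v a) := by
      have e1 : m₀ - m₁ = (m₀ - g a) - (g b - g a) - (m₁ - g b) := by abel
      have : ‖m₀ - m₁‖ ≤ (v c - v b) + 2 * (v b - v a) := by
        rw [e1]
        linarith [_root_.norm_sub_le (m₀ - g a - (g b - g a)) (m₁ - g b),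
          _root_.norm_sub_le (m₀ - g a) (g b - g a)]
      exact (apply_le_mul_of_norm_le this hu₀).trans (by linarith)
    simp only [sub_apply, map_sub] at q1 q3 q4 ⊢
    have q5 : 0 ≤ C * (b - a) := by positivity
    linarith
  set P := (1 / 2 * M₀ u₀ u₀ - m₀ u₀) - (1 / 2 * M₁ u₁ u₁ - m₁ u₁)
      + 2 * C * (c - b) + C * (b - a) + (v c - v b) + 2 * (v b - v a) with hP
  have hmain : (ξ₂ - ξ₁) u₁ ≤ (c - b) * P := by
    refine hDle.trans ?_
    have e1 : (ξ₂ - ξ₁) (u₁ - u₀) = (c - b) * (m₁ - M₁ u₁) (u₁ - u₀) + (-ρ) (u₁ - u₀) := by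
      rw [hξ]; rfl
    rw [e1]
    have := mul_le_mul_of_nonneg_left hquad hh₁.le
    rw [hP]
    linarith
  -- The sign of `P` allows the variable factor `(c - b) ^ 2` to be replaced by the common `τ ^ 2`,
  -- without which the potentials would not telescope.
  have hP0 : 0 ≤ P := nonneg_of_mul_nonneg_right (hD0.trans hmain) hh₁
  have e2 : (ξ₂ - ξ₁) (x₂ - x₁) = (c - b) * (ξ₂ - ξ₁) u₁ := by
    conv_lhs => rw [ed₁]
    rw [map_smul, smul_eq_mul]
  rw [e2]
  calc (c - b) * (ξ₂ - ξ₁) u₁ ≤ (c - b) * ((c - b) * P) := by gcongr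
    _ = (c - b) ^ 2 * P := by ring
    _ ≤ τ ^ 2 * P := by gcongr

end Evolution

/-! ### Summation of the one-step estimates. -/

/-- Discrete Gronwall inequality with variable steps. -/
theorem le_exp_mul_of_step_le {a s t : ℕ → ℝ} {c : ℝ} (hc : 0 ≤ c) {n : ℕ} (h0 : a 0 ≤ 0)
    (hs : ∀ k < n, 0 ≤ s k) (ht : ∀ k < n, t k ≤ t (k + 1)) (ha : ∀ k < n, 0 ≤ a k)
    (hstep : ∀ k < n, a (k + 1) ≤ (1 + c * (t (k + 1) - t k)) * a k + s k) :
    a n ≤ Real.exp (c * (t n - t 0)) * ∑ k ∈ Finset.range n, s k := by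
  induction n with
  | zero => simpa using h0
  | succ n ih =>
    have ih := ih (fun k hk => hs k (by omega)) (fun k hk => ht k (by omega))
      (fun k hk => ha k (by omega)) (fun k hk => hstep k (by omega))
    have htn : t 0 ≤ t (n + 1) := by
      have : ∀ m ≤ n + 1, t 0 ≤ t m := fun m => by
        induction m with
        | zero => simp
        | succ m ihm => exact fun hm => (ihm (by omega)).trans (ht m (by omega))
      exact this _ le_rfl
    rw [Finset.sum_range_succ, mul_add]
    refine (hstep n (by omega)).trans (add_le_add ?_ ?_)
    · have h1 : 1 + c * (t (n + 1) - t n) ≤ Real.exp (c * (t (n + 1) - t n)) := by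
        linarith [Real.add_one_le_exp (c * (t (n + 1) - t n))]
      calc _ ≤ Real.exp (c * (t (n + 1) - t n)) * (Real.exp (c * (t n - t 0))
            * ∑ k ∈ Finset.range n, s k) :=
            mul_le_mul h1 ih (ha n (by omega)) (Real.exp_nonneg _)
        _ = _ := by rw [← mul_assoc, ← Real.exp_add]; ring_nf
    · have h1 : 1 ≤ Real.exp (c * (t (n + 1) - t 0)) :=
        Real.one_le_exp (mul_nonneg hc (by linarith))
      nlinarith [hs n (by omega)]

/-- `n` implicit Euler steps on the nodes `t 0 < ⋯ < t n`, close to the solution `z`. -/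
structure EulerSteps {Z : Type*} [NormedAddCommGroup Z] [NormedSpace ℝ Z]
    (f ψ : Z → ℝ) (l : ℝ → Z →L[ℝ] ℝ) (z : ℝ → Z) (T Δ τ : ℝ) (n : ℕ) (t : ℕ → ℝ) (w : ℕ → Z) :
    Prop where
  t_zero : t 0 = 0
  w_zero : w 0 = z 0
  t_lt : ∀ k < n, t k < t (k + 1)
  t_sub_le : ∀ k < n, t (k + 1) - t k ≤ τ
  t_le : t n ≤ T
  norm_sub_le : ∀ k < n, ‖w (k + 1) - w k‖ ≤ t (k + 1) - t k
  stable : ∀ k ≤ n, ∀ x, (l (t k) - fderiv ℝ f (w k)) x ≤ ψ x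
  flow : ∀ k < n, ψ (w (k + 1) - w k)
    = (l (t (k + 1)) - fderiv ℝ f (w (k + 1))) (w (k + 1) - w k)
  close : ∀ k < n, ‖w k - z (t k)‖ ≤ Δ / 2

section ErrorBound

variable {Z : Type*} [NormedAddCommGroup Z] [NormedSpace ℝ Z]
    {f ψ : Z → ℝ} {l : ℝ → Z →L[ℝ] ℝ} {z : ℝ → Z} {T κ Δ r C M τ : ℝ} {Λ : ℝ≥0}
    {g : ℝ → Z →L[ℝ] ℝ} {v : ℝ → ℝ} {n : ℕ} {t : ℕ → ℝ} {w : ℕ → Z}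

namespace EulerSteps

theorem mono (S : EulerSteps f ψ l z T Δ τ n t w) : ∀ {j k : ℕ}, j ≤ k → k ≤ n → t j ≤ t k := by
  intro j k hjk
  induction k, hjk using Nat.le_induction with
  | base => exact fun _ => le_rfl
  | succ k _ ih => exact fun hk => (ih (by omega)).trans (S.t_lt k (by omega)).le

theorem mem_Icc (S : EulerSteps f ψ l z T Δ τ n t w) {k : ℕ} (hk : k ≤ n) : t k ∈ Icc 0 T :=
  ⟨S.t_zero ▸ S.mono (Nat.zero_le k) hk, (S.mono hk le_rfl).trans S.t_le⟩

/-- Closeness is assumed only before the last node; one further step moves the error by at most `(1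
+ Λ) τ`. This is what makes the error bound usable in an induction. -/
theorem mem_closedBall (S : EulerSteps f ψ l z T Δ τ n t w)
    (E : Evolution f ψ l z T κ Δ r C M Λ g v) (hτ : (1 + Λ) * τ ≤ Δ / 2) {k : ℕ} (hk : k ≤ n) :
    w k ∈ Metric.closedBall (z (t k)) Δ := by
  rw [mem_closedBall_iff_norm]
  have hΔ := E.Δ_pos
  rcases hk.lt_or_eq with hk | rfl
  · linarith [S.close k hk]
  · rcases k with _ | k
    · rw [S.t_zero, S.w_zero]; simpa using hΔ.le
    · have h1 := S.close k (by omega)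
      have h2 := S.norm_sub_le k (by omega)
      have h3 := S.t_sub_le k (by omega)
      have h4 := E.norm_sub_le (S.mem_Icc (k := k) (by omega)) (S.mem_Icc (k := k + 1) le_rfl)
      rw [abs_of_pos (sub_pos.2 (S.t_lt k (by omega)))] at h4
      have h5 : (Λ : ℝ) * (t (k + 1) - t k) ≤ Λ * τ := by gcongr
      have e1 : w (k + 1) - z (t (k + 1)) = (w (k + 1) - w k) + (w k - z (t k))
          - (z (t (k + 1)) - z (t k)) := by abel
      rw [e1]
      linarith [_root_.norm_sub_le (w (k + 1) - w k + (w k - z (t k))) (z (t (k + 1)) - z (t k)),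
        norm_add_le (w (k + 1) - w k) (w k - z (t k))]

/-- This order `τ²` bound, uniform in `n`, is what gives rate one instead of one half. -/
theorem sum_increment_le (S : EulerSteps f ψ l z T Δ τ n t w)
    (E : Evolution f ψ l z T κ Δ r C M Λ g v) (hτ : (1 + Λ) * τ ≤ Δ / 2) :
    ∑ k ∈ Finset.range n, ((l (t (k + 1)) - fderiv ℝ f (w (k + 1)))
        - (l (t k) - fderiv ℝ f (w k))) (w (k + 1) - w k)
      ≤ τ ^ 2 * (3 * (Λ + M) + 3 * C * T + 3 * (v T - v 0)) := by
  have hC := E.C_nonneg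
  have hM := E.M_nonneg
  have hT := E.T_pos
  have hΛ := Λ.coe_nonneg
  have h0T : (0 : ℝ) ∈ Icc 0 T := ⟨le_rfl, hT.le⟩
  have hTT : T ∈ Icc 0 T := ⟨hT.le, le_rfl⟩
  have hvT := E.v_mono h0T hTT hT.le
  have hball : ∀ k ≤ n, w k ∈ Metric.ball (0 : Z) r := fun k hk =>
    E.ball_subset _ (S.mem_Icc hk) (S.mem_closedBall E hτ hk)
  have hpot : ∀ k < n, |velocityPotential f l (t k) (t (k + 1)) (w k) (w (k + 1))| ≤ M + Λ :=
    fun k hk => E.abs_velocityPotential_le (S.mem_Icc hk.le) (S.mem_Icc hk) (S.t_lt k hk)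
      (hball k hk.le) (S.norm_sub_le k hk)
  -- The first step has no predecessor and is estimated directly. Its bound `Λ + M`, together with
  -- the initial potential, accounts for `2 * (Λ + M)`; the last potential supplies the third copy.
  have claim : ∀ j < n, ∑ k ∈ Finset.range (j + 1), ((l (t (k + 1)) - fderiv ℝ f (w (k + 1)))
        - (l (t k) - fderiv ℝ f (w k))) (w (k + 1) - w k)
      ≤ τ ^ 2 * (2 * (Λ + M) - velocityPotential f l (t j) (t (j + 1)) (w j) (w (j + 1))
        + 2 * C * t (j + 1) + C * t j + v (t (j + 1)) + 2 * v (t j) - 3 * v 0) := by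
    intro j
    induction j with
    | zero =>
      intro hn
      rw [zero_add, Finset.sum_range_one]
      have h1 := E.increment_le (S.mem_Icc hn.le) (S.mem_Icc hn) (S.t_lt 0 hn) (hball 0 hn.le)
        (hball 1 hn) (S.norm_sub_le 0 hn)
      have h2 := (abs_le.1 (hpot 0 hn)).2
      have h3 : 0 < t (0 + 1) - t 0 := sub_pos.2 (S.t_lt 0 hn)
      have h4 : (t (0 + 1) - t 0) ^ 2 ≤ τ ^ 2 := by
        gcongr; exact S.t_sub_le 0 hn
      have h5 := E.v_mono h0T (S.mem_Icc (k := 1) hn) (S.mem_Icc (k := 1) hn).1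
      have h6 := (S.mem_Icc (k := 1) hn).1
      refine h1.trans ?_
      calc (Λ + M) * (t (0 + 1) - t 0) ^ 2 ≤ (Λ + M) * τ ^ 2 := by gcongr
        _ = τ ^ 2 * (Λ + M) := mul_comm _ _
        _ ≤ _ := by
          refine mul_le_mul_of_nonneg_left ?_ (sq_nonneg τ)
          rw [S.t_zero] at h2 ⊢
          have := mul_nonneg hC h6
          simp only [zero_add] at h2 ⊢
          linarith
    | succ j ih =>
      intro hj
      have hj' : j < n := by omega
      rw [Finset.sum_range_succ]
      have h1 := E.increment_le_potential (S.mem_Icc hj'.le) (S.mem_Icc hj') (S.mem_Icc hj)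
        (S.t_lt j hj') (S.t_lt (j + 1) hj) (S.t_sub_le (j + 1) hj) (hball j hj'.le)
        (S.mem_closedBall E hτ hj') (hball _ hj) (S.norm_sub_le j hj') (S.norm_sub_le _ hj)
        (S.stable _ hj') (S.stable _ hj) (S.flow j hj') (S.flow _ hj)
      refine (add_le_add (ih hj') h1).trans (le_of_eq ?_)
      ring
  rcases n with _ | n
  · simp only [Finset.range_zero, Finset.sum_empty]
    have : 0 ≤ v T - v 0 := by linarith
    positivity
  · refine (claim n (Nat.lt_succ_self n)).trans (mul_le_mul_of_nonneg_left ?_ (sq_nonneg τ))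
    have h1 := (abs_le.1 (hpot n (Nat.lt_succ_self n))).1
    have i1 := S.mem_Icc (k := n) (Nat.le_succ n)
    have i2 := S.mem_Icc (k := n + 1) le_rfl
    have j1 := E.v_mono i1 hTT i1.2
    have j2 := E.v_mono i2 hTT i2.2
    have k1 := mul_le_mul_of_nonneg_left i1.2 hC
    have k2 := mul_le_mul_of_nonneg_left i2.2 hC
    linarith

end EulerSteps

/-- The Bregman distance to the solution controls the error. -/
theorem Evolution.sq_le_bregman (E : Evolution f ψ l z T κ Δ r C M Λ g v) {s : ℝ} {x : Z}
    (hs : s ∈ Icc 0 T) (hx : x ∈ Metric.closedBall (z s) Δ) :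
    κ / 2 * ‖x - z s‖ ^ 2 ≤ bregman f x (z s) :=
  mul_sq_le_bregman E.contDiff fun p hp => E.convex s hs p
    ((convex_closedBall _ _).segment_subset (Metric.mem_closedBall_self E.Δ_pos.le) hx hp)

/-- Implicit Euler steps converge with rate one. -/
theorem Evolution.exists_error_bound (E : Evolution f ψ l z T κ Δ r C M Λ g v) :
    ∃ K, 0 < K ∧ ∀ τ, 0 < τ → (1 + Λ) * τ ≤ Δ / 2 → ∀ (n : ℕ) (t : ℕ → ℝ) (w : ℕ → Z),
      EulerSteps f ψ l z T Δ τ n t w → ‖w n - z (t n)‖ ≤ K * τ := by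
  have hC := E.C_nonneg
  have hM := E.M_nonneg
  have hT := E.T_pos
  have hκ := E.κ_pos
  have hΛ := Λ.coe_nonneg
  have h0T : (0 : ℝ) ∈ Icc 0 T := ⟨le_rfl, hT.le⟩
  have hTT : T ∈ Icc 0 T := ⟨hT.le, le_rfl⟩
  have hvT : 0 ≤ v T - v 0 := sub_nonneg.2 (E.v_mono h0T hTT hT.le)
  -- The Taylor term gives `C Λ · 2 e²`, and `e² ≤ (2 / κ) B` for the Bregman distance `B`; `c₂` and
  -- `c₃` collect the sources from the load and from the step size.
  set c₁ : ℝ := 4 * C * Λ / κ with hc₁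
  set c₂ : ℝ := 2 * (1 + Λ) with hc₂
  set c₃ : ℝ := 2 * C * (1 + Λ) + 2 * C * Λ * (1 + Λ) ^ 2 with hc₃
  have hc₁0 : 0 ≤ c₁ := by positivity
  have hc₂0 : 0 ≤ c₂ := by positivity
  have hc₃0 : 0 ≤ c₃ := by positivity
  set Q : ℝ := Real.exp (c₁ * T) * (3 * (Λ + M) + 3 * C * T + 3 * (v T - v 0)
    + (c₂ * (v T - v 0) + c₃ * T)) with hQ
  have hQ0 : 0 ≤ Q := by positivity
  refine ⟨Real.sqrt (2 / κ * Q) + 1, by positivity, fun τ hτ0 hτ n t w S => ?_⟩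
  have hcb : ∀ k ≤ n, w k ∈ Metric.closedBall (z (t k)) Δ := fun k hk => S.mem_closedBall E hτ hk
  have hball : ∀ k ≤ n, w k ∈ Metric.ball (0 : Z) r := fun k hk =>
    E.ball_subset _ (S.mem_Icc hk) (hcb k hk)
  have hB : ∀ k ≤ n, κ / 2 * ‖w k - z (t k)‖ ^ 2 ≤ bregman f (w k) (z (t k)) := fun k hk =>
    E.sq_le_bregman (S.mem_Icc hk) (hcb k hk)
  set D : ℕ → ℝ := fun k => ((l (t (k + 1)) - fderiv ℝ f (w (k + 1)))
        - (l (t k) - fderiv ℝ f (w k))) (w (k + 1) - w k) with hD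
  have hD0 : ∀ k < n, 0 ≤ D k := fun k hk => by
    have h1 := S.flow k hk
    have h2 := S.stable k hk.le (w (k + 1) - w k)
    rw [h1] at h2
    exact sub_nonneg.2 h2
  have hV : ∀ k < n, 0 ≤ v (t (k + 1)) - v (t k) := fun k hk =>
    sub_nonneg.2 (E.v_mono (S.mem_Icc hk.le) (S.mem_Icc hk) (S.t_lt k hk).le)
  have gron := le_exp_mul_of_step_le (a := fun k => bregman f (w k) (z (t k)))
    (s := fun k => D k + τ ^ 2 * (c₂ * (v (t (k + 1)) - v (t k)) + c₃ * (t (k + 1) - t k)))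
    (t := t) (c := c₁) (n := n) hc₁0 ?_ ?_ (fun k hk => (S.t_lt k hk).le) ?_ ?_
  · have hs1 := S.sum_increment_le E hτ
    rw [Finset.sum_add_distrib, ← Finset.mul_sum, Finset.sum_add_distrib, ← Finset.mul_sum,
      ← Finset.mul_sum, Finset.sum_range_sub (fun k => v (t k)), Finset.sum_range_sub t,
      S.t_zero, sub_zero] at gron
    have i1 := S.mem_Icc (k := n) le_rfl
    have j1 := E.v_mono i1 hTT i1.2
    have j2 := E.v_mono h0T i1 i1.1
    have hbQ : bregman f (w n) (z (t n)) ≤ Q * τ ^ 2 := by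
      refine gron.trans ?_
      have e1 : Q * τ ^ 2 = Real.exp (c₁ * T) * (τ ^ 2 * (3 * (Λ + M) + 3 * C * T
          + 3 * (v T - v 0)) + τ ^ 2 * (c₂ * (v T - v 0) + c₃ * T)) := by rw [hQ]; ring
      rw [e1]
      refine mul_le_mul (Real.exp_le_exp.2 (by gcongr; exact i1.2)) (add_le_add hs1 ?_) ?_
        (Real.exp_nonneg _)
      · have := i1.2
        gcongr
      · refine add_nonneg (Finset.sum_nonneg fun k hk => hD0 k (Finset.mem_range.1 hk)) ?_
        have := i1.1
        have : 0 ≤ v (t n) - v 0 := by linarith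
        positivity
    have h1 : ‖w n - z (t n)‖ ^ 2 ≤ 2 / κ * Q * τ ^ 2 := by
      have := (hB n le_rfl).trans hbQ
      have e1 : ‖w n - z (t n)‖ ^ 2 = 2 / κ * (κ / 2 * ‖w n - z (t n)‖ ^ 2) := by field_simp
      rw [e1, mul_assoc]
      gcongr
    have h2 : ‖w n - z (t n)‖ ≤ Real.sqrt (2 / κ * Q) * τ := by
      rw [← Real.sqrt_sq hτ0.le, ← Real.sqrt_mul (by positivity)]
      exact Real.le_sqrt_of_sq_le h1
    linarith
  · simp [S.t_zero, S.w_zero, bregman]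
  · intro k hk
    have h1 := hV k hk
    have h2 := sub_pos.2 (S.t_lt k hk)
    have h3 := hD0 k hk
    positivity
  · intro k hk
    exact le_trans (by positivity) (hB k hk.le)
  · intro k hk
    have h1 := E.bregman_step (S.mem_Icc hk.le) (S.mem_Icc hk) (S.t_lt k hk) (hball k hk.le)
      (hball (k + 1) hk) (S.norm_sub_le k hk) (S.stable k hk.le) (S.stable (k + 1) hk)
      (S.flow k hk)
    have hbk := hB k hk.le
    have hVk := hV k hk
    have hh := sub_pos.2 (S.t_lt k hk)
    have hhτ := S.t_sub_le k hk
    change _ ≤ (1 + c₁ * (t (k + 1) - t k)) * bregman f (w k) (z (t k)) + _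
    refine h1.trans ?_
    change bregman f (w k) (z (t k)) + D k + _ ≤ _
    set h := t (k + 1) - t k
    set e := ‖w k - z (t k)‖
    set V := v (t (k + 1)) - v (t k)
    set B := bregman f (w k) (z (t k))
    have hh2 : h ^ 2 ≤ τ ^ 2 := by gcongr
    have i1 : C * Λ * (e + (1 + Λ) * h) ^ 2 ≤ c₁ * B + 2 * C * Λ * (1 + Λ) ^ 2 * τ ^ 2 := by
      have a1 : (e + (1 + Λ) * h) ^ 2 ≤ 2 * e ^ 2 + 2 * (1 + Λ) ^ 2 * h ^ 2 := by
        nlinarith [sq_nonneg (e - (1 + Λ) * h)]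
      have a2 : e ^ 2 ≤ 2 / κ * B := by
        have e1 : e ^ 2 = 2 / κ * (κ / 2 * e ^ 2) := by field_simp
        rw [e1]; gcongr
      calc C * Λ * (e + (1 + Λ) * h) ^ 2
          ≤ C * Λ * (2 * (2 / κ * B) + 2 * (1 + Λ) ^ 2 * τ ^ 2) := by
            have : 2 * e ^ 2 + 2 * (1 + (Λ : ℝ)) ^ 2 * h ^ 2
              ≤ 2 * (2 / κ * B) + 2 * (1 + Λ) ^ 2 * τ ^ 2 := by gcongr
            gcongr
            exact a1.trans this
        _ = _ := by rw [hc₁]; ring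
    have i2 : 2 * C * (1 + Λ) * h ^ 2 ≤ 2 * C * (1 + Λ) * τ ^ 2 := by gcongr
    have i3 : h * (2 * (1 + Λ) * V * h) ≤ τ ^ 2 * (c₂ * V) := by
      calc h * (2 * (1 + Λ) * V * h) = h ^ 2 * (c₂ * V) := by rw [hc₂]; ring
        _ ≤ _ := by gcongr
    have i4 := mul_le_mul_of_nonneg_left (add_le_add i2 i1) hh.le
    have e3 : h * (2 * C * (1 + ↑Λ) * τ ^ 2 + (c₁ * B + 2 * C * ↑Λ * (1 + ↑Λ) ^ 2 * τ ^ 2))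
        = c₁ * h * B + τ ^ 2 * (c₃ * h) := by rw [hc₃]; ring
    rw [e3] at i4
    linarith

end ErrorBound

/-- For `s ≥ 1` one has `b ≤ |b| s`, and a factor `s` can be divided out; the summand 1 covers
smaller `s`. -/
theorem le_of_coercive {α a b s : ℝ} (hα : 0 < α) (ha : 0 ≤ a) (hs : 0 ≤ s)
    (h : α / 2 * s ^ 2 - a * s ≤ b) : s ≤ 1 + 2 * (a + |b|) / α := by
  by_contra! hlt
  have hb := abs_nonneg b
  have h1 : 2 * (a + |b|) / α ≤ s := by linarith
  rw [div_le_iff₀ hα] at h1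
  have h2 : 1 < s := lt_of_le_of_lt (by
    have : 0 ≤ 2 * (a + |b|) / α := by positivity
    linarith) hlt
  have h3 : 2 * (a + |b|) < s * α - α := by
    have : 2 * (a + |b|) / α < s - 1 := by linarith
    rw [div_lt_iff₀ hα] at this; linarith
  nlinarith [le_abs_self b]

variable {Z V X : Type*}
    [NormedAddCommGroup Z] [InnerProductSpace ℝ Z]
    [NormedAddCommGroup V] [InnerProductSpace ℝ V]
    [NormedAddCommGroup X] [NormedSpace ℝ X]

/-! ### The energy and the dissipation of a system -/

namespace System

/-- The part of the energy that does not depend on time. -/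
noncomputable def potential (S : System Z V X) (z : Z) : ℝ := 1 / 2 * S.A z z + S.F z

/-- The load as a functional on `Z`. -/
noncomputable def load (S : System Z V X) (t : ℝ) : Z →L[ℝ] ℝ := (S.ℓ t).comp S.ι

theorem energy_eq (S : System Z V X) (t : ℝ) (z : Z) :
    S.energy t z = S.potential z - S.load t z := rfl

theorem load_sub_apply_le (S : System Z V X) {L : ℝ} {s t : ℝ} (h : ‖S.ℓ t - S.ℓ s‖ ≤ L) (u : Z) :
    (S.load t - S.load s) u ≤ L * ‖S.ι u‖ :=
  apply_le_mul_of_norm_le (φ := S.ℓ t - S.ℓ s) h le_rfl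

/-- The set of competitors in a step of the scheme. -/
def competitors (S : System Z V X) (τ : ℝ) (x : Z) : Set Z := {y | ‖S.ι (y - x)‖ ≤ τ}

theorem convex_competitors (S : System Z V X) (τ : ℝ) (x : Z) : Convex ℝ (S.competitors τ x) := by
  have h : S.competitors τ x = S.ι ⁻¹' Metric.closedBall (S.ι x) τ := by
    ext y; simp [competitors, dist_eq_norm]
  rw [h]
  exact (convex_closedBall _ _).is_linear_preimage S.ι.toLinearMap.isLinear

theorem isClosed_competitors (S : System Z V X) (τ : ℝ) (x : Z) :
    IsClosed (S.competitors τ x) :=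
  isClosed_le (by fun_prop) continuous_const

theorem self_mem_competitors (S : System Z V X) {τ : ℝ} (hτ : 0 ≤ τ) (x : Z) :
    x ∈ S.competitors τ x := by simpa [competitors] using hτ

/-- The functional minimized in a step of the scheme. -/
noncomputable def stepEnergy (S : System Z V X) (t : ℝ) (x y : Z) : ℝ :=
  S.energy t y + S.R (S.ι (y - x))

namespace Admissible

variable {S : System Z V X}

theorem A_add_add (hS : S.Admissible) (u v : Z) :
    S.A (u + v) (u + v) = S.A u u + 2 * S.A u v + S.A v v := by
  simp only [map_add, add_apply, hS.A_symm v u]; ring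

theorem hasFDerivAt_quadratic (hS : S.Admissible) (z : Z) :
    HasFDerivAt (fun z => 1 / 2 * S.A z z) (S.A z) z := by
  have h1 := (S.A.hasFDerivAt (x := z)).clm_apply (hasFDerivAt_id z)
  refine (h1.const_mul (1 / 2)).congr_fderiv ?_
  ext v
  simp [hS.A_symm v z]
  ring

theorem contDiff_potential (hS : S.Admissible) : ContDiff ℝ 2 S.potential := by
  have h := hS.F_contDiff
  unfold potential
  fun_prop

theorem fderiv_potential (hS : S.Admissible) (z : Z) :
    fderiv ℝ S.potential z = S.A z + fderiv ℝ S.F z :=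
  ((hS.hasFDerivAt_quadratic z).add
    (hS.F_contDiff.differentiable (by norm_num) z).hasFDerivAt).fderiv

theorem hasFDerivAt_energy (hS : S.Admissible) (t : ℝ) (z : Z) :
    HasFDerivAt (S.energy t) (fderiv ℝ S.potential z - S.load t) z :=
  (hS.contDiff_potential.differentiable (by norm_num) z).hasFDerivAt.sub
    (S.load t).hasFDerivAt

theorem dEnergy_eq (hS : S.Admissible) (t : ℝ) :
    S.dEnergy t = fun z => fderiv ℝ S.potential z - S.load t :=
  funext fun z => (hS.hasFDerivAt_energy t z).fderiv

theorem neg_dEnergy_eq (hS : S.Admissible) (t : ℝ) (z : Z) :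
    -S.dEnergy t z = S.load t - fderiv ℝ S.potential z := by
  rw [hS.dEnergy_eq, neg_sub]

theorem d2Energy_eq (hS : S.Admissible) (t : ℝ) (z : Z) :
    S.d2Energy t z = fderiv ℝ (fderiv ℝ S.potential) z := by
  rw [d2Energy, hS.dEnergy_eq, fderiv_sub_const]

theorem norm_comp_ι_le (hS : S.Admissible) (φ : V →L[ℝ] ℝ) : ‖φ.comp S.ι‖ ≤ ‖φ‖ := by
  refine ContinuousLinearMap.opNorm_le_bound _ (norm_nonneg _) fun z => ?_
  exact (φ.le_opNorm _).trans (by gcongr; exact hS.ι_norm_le z)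

theorem R_zero (hS : S.Admissible) : S.R 0 = 0 := by
  obtain ⟨ρ₁, ρ₂, _, _, h⟩ := hS.R_bounds
  have := (h 0).2
  simp at this
  exact le_antisymm this (hS.R_nonneg 0)

theorem R_add_le (hS : S.Admissible) (u v : V) : S.R (u + v) ≤ S.R u + S.R v := by
  have h := hS.R_convex.2 (mem_univ ((2 : ℝ) • u)) (mem_univ ((2 : ℝ) • v))
    (by norm_num : (0 : ℝ) ≤ 1 / 2) (by norm_num : (0 : ℝ) ≤ 1 / 2) (by norm_num)
  rw [hS.R_homogeneous 2 two_pos, hS.R_homogeneous 2 two_pos, smul_smul, smul_smul] at h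
  norm_num at h
  linarith

theorem continuous_R (hS : S.Admissible) : Continuous S.R := by
  obtain ⟨ρ₁, ρ₂, _, h2, h⟩ := hS.R_bounds
  refine (LipschitzWith.of_le_add_mul ⟨ρ₂, h2.le⟩ fun u v => ?_).continuous
  have h1 := hS.R_add_le v (u - v)
  rw [add_sub_cancel] at h1
  rw [dist_eq_norm]
  exact h1.trans (by gcongr; exact (h _).2)

theorem dissipation_zero (hS : S.Admissible) : S.dissipation 0 = 0 := by
  rw [dissipation, map_zero, hS.R_zero]

theorem dissipation_smul (hS : S.Admissible) (c : ℝ) (hc : 0 < c) (v : Z) :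
    S.dissipation (c • v) = c * S.dissipation v := by
  rw [dissipation, map_smul, hS.R_homogeneous c hc, dissipation]

theorem mem_subdifferential_dissipation (hS : S.Admissible) {u : Z} {ξ : Z →L[ℝ] ℝ} :
    ξ ∈ subdifferential S.dissipation u ↔
      S.dissipation u = ξ u ∧ ∀ w, ξ w ≤ S.dissipation w :=
  mem_subdifferential_iff hS.dissipation_zero hS.dissipation_smul

/-- On bounded sets, `F` is Lipschitz continuous with respect to the norm of `V`. -/
theorem exists_F_lipschitz (hS : S.Admissible) (r : ℝ) : ∃ M : ℝ, 0 ≤ M ∧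
    (∀ x ∈ Metric.ball (0 : Z) r, ∀ d, |fderiv ℝ S.F x d| ≤ M * ‖S.ι d‖) ∧
    ∀ x ∈ Metric.ball (0 : Z) r, ∀ y ∈ Metric.ball (0 : Z) r,
      |S.F y - S.F x| ≤ M * ‖S.ι (y - x)‖ := by
  obtain ⟨G, hG, hFG, C, q, hq, hb⟩ := hS.F_lower_order
  rcases le_or_gt r 0 with hr | hr
  · exact ⟨0, le_rfl, by simp [Metric.ball_eq_empty.2 hr], by simp [Metric.ball_eq_empty.2 hr]⟩
  have hG' : ∀ x ∈ Metric.ball (0 : Z) r, ‖fderiv ℝ G x‖ ≤ |C| * (1 + r ^ q) := fun x hx => by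
    refine ContinuousLinearMap.opNorm_le_bound _ (by positivity) fun d => (hb x d).trans ?_
    rw [mem_ball_zero_iff] at hx
    have : ‖x‖ ^ q ≤ r ^ q := Real.rpow_le_rpow (norm_nonneg _) hx.le (by linarith)
    gcongr
    exact le_abs_self C
  set M := ‖G 0‖ + |C| * (1 + r ^ q) * r with hM
  have hM0 : 0 ≤ M := by positivity
  have hGM : ∀ x ∈ Metric.ball (0 : Z) r, ‖G x‖ ≤ M := fun x hx => by
    have h1 := (convex_ball (0 : Z) r).norm_image_sub_le_of_norm_fderiv_le
      (fun p _ => hG.differentiable (by norm_num) p) hG' (Metric.mem_ball_self hr) hx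
    rw [sub_zero] at h1
    have h2 : ‖G x‖ ≤ ‖G 0‖ + ‖G x - G 0‖ := by
      simpa using norm_add_le (G 0) (G x - G 0)
    have h3 : |C| * (1 + r ^ q) * ‖x‖ ≤ |C| * (1 + r ^ q) * r := by
      gcongr; exact (mem_ball_zero_iff.1 hx).le
    linarith
  have hDF : ∀ x ∈ Metric.ball (0 : Z) r, ∀ d, |fderiv ℝ S.F x d| ≤ M * ‖S.ι d‖ :=
    fun x hx d => by
      rw [hFG, ← Real.norm_eq_abs]
      exact ((G x).le_opNorm (S.ι d)).trans
        (mul_le_mul_of_nonneg_right (hGM x hx) (norm_nonneg _))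
  refine ⟨M, hM0, hDF, fun x hx y hy => ?_⟩
  have hd : ∀ s : ℝ, HasDerivAt (fun s : ℝ => S.F (x + s • (y - x)))
      (fderiv ℝ S.F (x + s • (y - x)) (y - x)) s := fun s =>
    (hS.F_contDiff.differentiable (by norm_num) _).hasFDerivAt.comp_hasDerivAt s
      (hasDerivAt_segment x (y - x) s)
  obtain ⟨c, hc, h⟩ := exists_hasDerivAt_eq_slope _ _ (zero_lt_one' ℝ)
    (fun s _ => (hd s).continuousAt.continuousWithinAt) (fun s _ => hd s)
  have hp : x + c • (y - x) ∈ Metric.ball (0 : Z) r :=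
    (convex_ball _ _).segment_subset hx hy (by
      rw [segment_eq_image']; exact ⟨c, ⟨hc.1.le, hc.2.le⟩, rfl⟩)
  have h2 := hDF _ hp (y - x)
  rw [h] at h2
  simpa using h2

/-- On bounded sets, the second derivative of the energy is Lipschitz continuous and bounded. -/
theorem exists_second_bounds (hS : S.Admissible) {r : ℝ} (hr : 0 < r) : ∃ C M : ℝ, 0 ≤ C ∧
    (∀ x ∈ Metric.ball (0 : Z) r, ∀ y ∈ Metric.ball (0 : Z) r,
      ‖fderiv ℝ (fderiv ℝ S.potential) x - fderiv ℝ (fderiv ℝ S.potential) y‖ ≤ C * ‖x - y‖) ∧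
    ∀ x ∈ Metric.ball (0 : Z) r, ‖fderiv ℝ (fderiv ℝ S.potential) x‖ ≤ M := by
  -- Any time will do, since the load is linear in the state and does not affect the second
  -- derivative. The one-sided bound becomes two-sided by exchanging the two points.
  obtain ⟨C, hC0, hC⟩ := hS.energy_C21 0 ⟨le_rfl, hS.T_pos.le⟩ r hr
  simp only [hS.d2Energy_eq] at hC
  have hlip : ∀ x ∈ Metric.ball (0 : Z) r, ∀ y ∈ Metric.ball (0 : Z) r,
      ‖fderiv ℝ (fderiv ℝ S.potential) x - fderiv ℝ (fderiv ℝ S.potential) y‖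
        ≤ 2 * C * ‖x - y‖ := fun x hx y hy => by
    rw [mul_assoc]
    refine norm_le_of_forall_apply_self_le (by positivity) (fun u v => ?_) fun v => ?_
    · simp only [sub_apply, fderiv_fderiv_comm hS.contDiff_potential _ u v]
    · have h1 := hC x hx y hy v
      have h2 := hC y hy x hx v
      rw [norm_sub_rev] at h2
      rw [abs_le]
      simp only [sub_apply] at h1 h2 ⊢
      constructor <;> linarith
  refine ⟨2 * C, ‖fderiv ℝ (fderiv ℝ S.potential) 0‖ + 2 * C * r, by positivity, hlip,
    fun x hx => ?_⟩
  have h1 := hlip x hx 0 (Metric.mem_ball_self hr)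
  rw [sub_zero] at h1
  have h2 : ‖fderiv ℝ (fderiv ℝ S.potential) x‖ ≤ ‖fderiv ℝ (fderiv ℝ S.potential) 0‖
      + ‖fderiv ℝ (fderiv ℝ S.potential) x - fderiv ℝ (fderiv ℝ S.potential) 0‖ := by
    simpa using norm_add_le (fderiv ℝ (fderiv ℝ S.potential) 0)
      (fderiv ℝ (fderiv ℝ S.potential) x - fderiv ℝ (fderiv ℝ S.potential) 0)
  have h3 : 2 * C * ‖x‖ ≤ 2 * C * r := by
    gcongr; exact (mem_ball_zero_iff.1 hx).le
  linarith

/-! ### Existence of minimizers -/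

theorem continuous_stepEnergy (hS : S.Admissible) (t : ℝ) (x : Z) :
    Continuous (S.stepEnergy t x) := by
  have h1 : Continuous (S.energy t) :=
    continuous_iff_continuousAt.2 fun z => (hS.hasFDerivAt_energy t z).continuousAt
  exact h1.add (hS.continuous_R.comp (by fun_prop))

/-- Midpoint estimate, which replaces uniform convexity of the functional of the scheme. -/
theorem stepEnergy_midpoint_le (hS : S.Admissible) {α M r t : ℝ} (hα : ∀ z, α * ‖z‖ ^ 2 ≤ S.A z z)
    (hM : ∀ x ∈ Metric.ball (0 : Z) r, ∀ y ∈ Metric.ball (0 : Z) r,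
      |S.F y - S.F x| ≤ M * ‖S.ι (y - x)‖) {x u v : Z} (hu : u ∈ Metric.ball (0 : Z) r)
    (hv : v ∈ Metric.ball (0 : Z) r) :
    S.stepEnergy t x ((1 / 2 : ℝ) • u + (1 / 2 : ℝ) • v) ≤
      1 / 2 * (S.stepEnergy t x u + S.stepEnergy t x v) - α / 8 * ‖u - v‖ ^ 2
        + M / 2 * ‖S.ι (u - v)‖ := by
  set p := (1 / 2 : ℝ) • u + (1 / 2 : ℝ) • v with hp
  have hpb : p ∈ Metric.ball (0 : Z) r :=
    (convex_ball _ _) hu hv (by norm_num) (by norm_num) (by norm_num)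
  have hpu : p - u = (-(1 / 2) : ℝ) • (u - v) := by rw [hp]; module
  have hpv : p - v = (1 / 2 : ℝ) • (u - v) := by rw [hp]; module
  have h1 := (abs_le.1 (hM u hu p hpb)).2
  have h2 := (abs_le.1 (hM v hv p hpb)).2
  rw [hpu, map_smul, norm_smul, Real.norm_eq_abs, abs_neg,
    abs_of_pos (by norm_num : (0 : ℝ) < 1 / 2)] at h1
  rw [hpv, map_smul, norm_smul, Real.norm_eq_abs, abs_of_pos (by norm_num : (0 : ℝ) < 1 / 2)] at h2
  -- The parallelogram identity for `A` yields the gain in `‖u - v‖`; the possibly nonconvex `F`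
  -- costs only the weaker `V`-norm.
  have h3 : S.A p p = 1 / 2 * S.A u u + 1 / 2 * S.A v v - 1 / 4 * S.A (u - v) (u - v) := by
    simp only [hp, map_add, map_sub, map_smul, add_apply, sub_apply, smul_apply, smul_eq_mul,
      hS.A_symm v u]
    ring
  have h4 := hα (u - v)
  have h5 : S.R (S.ι (p - x)) ≤ 1 / 2 * S.R (S.ι (u - x)) + 1 / 2 * S.R (S.ι (v - x)) := by
    have e1 : S.ι (p - x) = (1 / 2 : ℝ) • S.ι (u - x) + (1 / 2 : ℝ) • S.ι (v - x) := by
      rw [← map_smul, ← map_smul, ← map_add]; congr 1; rw [hp]; module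
    rw [e1]
    exact hS.R_convex.2 (mem_univ _) (mem_univ _) (by norm_num) (by norm_num) (by norm_num)
  have h6 : S.ℓ t (S.ι p) = 1 / 2 * S.ℓ t (S.ι u) + 1 / 2 * S.ℓ t (S.ι v) := by
    simp [hp]
  unfold stepEnergy energy
  rw [h3, h6]
  linarith

theorem le_stepEnergy (hS : S.Admissible) {α : ℝ} (hα : ∀ z, α * ‖z‖ ^ 2 ≤ S.A z z) (t : ℝ)
    (x y : Z) : α / 2 * ‖y‖ ^ 2 - ‖S.load t‖ * ‖y‖ ≤ S.stepEnergy t x y := by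
  have h1 := hα y
  have h2 := hS.F_nonneg y
  have h3 := hS.R_nonneg (S.ι (y - x))
  have h4 : S.load t y ≤ ‖S.load t‖ * ‖y‖ := apply_le_mul_of_norm_le le_rfl le_rfl
  rw [stepEnergy, energy_eq, potential]
  linarith

/-- A minimizing sequence is bounded in `Z`, so by compactness a subsequence is Cauchy in `V`. The
midpoint estimate upgrades this to Cauchy in `Z`, and no weak convergence is needed. -/
theorem exists_isMinOn (hS : S.Admissible) [CompleteSpace Z] (t τ : ℝ) (hτ : 0 ≤ τ) (x : Z) :
    ∃ y ∈ S.competitors τ x, IsMinOn (S.stepEnergy t x) (S.competitors τ x) y := by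
  obtain ⟨α, hα0, hα⟩ := hS.A_coercive
  set a := ‖S.load t‖
  have hlow := hS.le_stepEnergy hα t x
  have hbdd : BddBelow (S.stepEnergy t x '' S.competitors τ x) := by
    refine ⟨-(a ^ 2 / (2 * α)), ?_⟩
    rintro _ ⟨y, -, rfl⟩
    refine le_trans ?_ (hlow y)
    have : α / 2 * ‖y‖ ^ 2 - a * ‖y‖ + a ^ 2 / (2 * α) = α / 2 * (‖y‖ - a / α) ^ 2 := by
      field_simp; ring
    have h2 : 0 ≤ α / 2 * (‖y‖ - a / α) ^ 2 := by positivity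
    linarith
  set m := sInf (S.stepEnergy t x '' S.competitors τ x) with hm
  have hne : (S.stepEnergy t x '' S.competitors τ x).Nonempty :=
    ⟨_, x, S.self_mem_competitors hτ x, rfl⟩
  have hseq : ∀ n : ℕ, ∃ y ∈ S.competitors τ x, S.stepEnergy t x y < m + 1 / ((n : ℝ) + 1) :=
    fun n => by
      obtain ⟨_, ⟨y, hy, rfl⟩, h⟩ := exists_lt_of_csInf_lt hne
        (lt_add_of_pos_right m (by positivity : (0 : ℝ) < 1 / ((n : ℝ) + 1)))
      exact ⟨y, hy, h⟩
  choose u huC hu using hseq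
  have hone : ∀ n : ℕ, 1 / ((n : ℝ) + 1) ≤ 1 := fun n => by
    rw [div_le_one (by positivity)]; linarith [n.cast_nonneg (α := ℝ)]
  set ρ := 1 + 2 * (a + |m + 1|) / α with hρ
  have hbd : ∀ n, ‖u n‖ ≤ ρ := fun n =>
    le_of_coercive hα0 (norm_nonneg _) (norm_nonneg _)
      ((hlow (u n)).trans ((hu n).le.trans (by linarith [hone n])))
  have hcomp := hS.ι_compact.isCompact_closure_image_closedBall (f := S.ι.toLinearMap) ρ
  obtain ⟨_, -, φ, hφ, hlim⟩ := hcomp.tendsto_subseq (x := fun n => S.ι (u n))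
    (fun n => subset_closure ⟨u n, by simpa using hbd n, rfl⟩)
  have hcau := hlim.cauchySeq
  obtain ⟨M, hM0, -, hM⟩ := hS.exists_F_lipschitz (ρ + 1)
  have hball : ∀ n, u n ∈ Metric.ball (0 : Z) (ρ + 1) := fun n => by
    rw [mem_ball_zero_iff]; linarith [hbd n]
  have hcauchy : CauchySeq fun n => u (φ n) := by
    rw [Metric.cauchySeq_iff]
    intro ε hε
    -- Chosen so that `(1 + M / 2) η` is half of `α / 8 * ε ^ 2`.
    set η := α * ε ^ 2 / (16 * (1 + M / 2)) with hη
    have hη0 : 0 < η := by positivity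
    obtain ⟨N₁, hN₁⟩ := Metric.cauchySeq_iff.1 hcau η hη0
    obtain ⟨N₂, hN₂⟩ := exists_nat_one_div_lt hη0
    refine ⟨max N₁ N₂, fun i hi j hj => ?_⟩
    have hlt : ∀ k ≥ max N₁ N₂, S.stepEnergy t x (u (φ k)) < m + η := fun k hk => by
      refine (hu (φ k)).trans_le ?_
      have h1 : N₂ ≤ φ k := (le_max_right N₁ N₂).trans (hk.trans hφ.le_apply)
      have h2 : 1 / ((φ k : ℝ) + 1) ≤ 1 / ((N₂ : ℝ) + 1) := by gcongr
      linarith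
    have h1 := hN₁ i ((le_max_left _ _).trans hi) j ((le_max_left _ _).trans hj)
    rw [dist_eq_norm] at h1 ⊢
    simp only [Function.comp_apply, ← map_sub] at h1
    have h2 := hS.stepEnergy_midpoint_le (t := t) (x := x) hα hM (hball (φ i)) (hball (φ j))
    have h3 : m ≤ S.stepEnergy t x ((1 / 2 : ℝ) • u (φ i) + (1 / 2 : ℝ) • u (φ j)) :=
      csInf_le hbdd ⟨_, S.convex_competitors τ x (huC _) (huC _) (by norm_num) (by norm_num)
        (by norm_num), rfl⟩
    have h4 := hlt i hi
    have h5 := hlt j hj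
    have h6 : M / 2 * ‖S.ι (u (φ i) - u (φ j))‖ ≤ M / 2 * η := by gcongr
    have h7 : α / 8 * ‖u (φ i) - u (φ j)‖ ^ 2 < (1 + M / 2) * η := by linarith
    have h8 : (1 + M / 2) * η = α / 8 * ε ^ 2 / 2 := by rw [hη]; field_simp; ring
    have h9 : ‖u (φ i) - u (φ j)‖ ^ 2 < ε ^ 2 := by
      rw [h8] at h7
      have : α / 8 * ‖u (φ i) - u (φ j)‖ ^ 2 < α / 8 * ε ^ 2 := by
        have : 0 < α / 8 * ε ^ 2 := by positivity
        linarith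
      exact lt_of_mul_lt_mul_left this (by positivity)
    exact lt_of_pow_lt_pow_left₀ 2 hε.le h9
  obtain ⟨y, hy⟩ := cauchySeq_tendsto_of_complete hcauchy
  refine ⟨y, (S.isClosed_competitors τ x).mem_of_tendsto hy (Filter.Eventually.of_forall
    fun n => huC (φ n)), ?_⟩
  have hle : S.stepEnergy t x y ≤ m := by
    have h1 := ((hS.continuous_stepEnergy t x).tendsto y).comp hy
    have h2 : Filter.Tendsto (fun n : ℕ => m + 1 / ((n : ℝ) + 1)) Filter.atTop (nhds (m + 0)) :=
      tendsto_one_div_add_atTop_nhds_zero_nat.const_add m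
    rw [add_zero] at h2
    refine le_of_tendsto_of_tendsto' h1 (h2.comp hφ.tendsto_atTop) fun n => (hu (φ n)).le
  exact fun p hp => hle.trans (csInf_le hbdd ⟨p, hp, rfl⟩)

theorem exists_isLocalMinScheme (hS : S.Admissible) [CompleteSpace Z] {τ : ℝ} (hτ : 0 ≤ τ) :
    ∃ (t : ℕ → ℝ) (y : ℕ → Z), S.IsLocalMinScheme τ t y := by
  choose step hstep hmin using fun (t : ℝ) (x : Z) => hS.exists_isMinOn t τ hτ x
  set s : ℕ → ℝ × Z := fun n => Nat.rec ((0 : ℝ), S.z₀)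
    (fun _ p => (min (p.1 + τ - ‖S.ι (step p.1 p.2 - p.2)‖) S.T, step p.1 p.2)) n
  exact ⟨fun n => (s n).1, fun n => (s n).2, rfl, rfl, fun k => hstep _ _, fun k => hmin _ _,
    fun k => rfl⟩

end Admissible
end System

/-! ### Properties of the minimizers -/

namespace System.Admissible

variable {S : System Z V X}

/-- Variational inequality for the minimizers of the scheme. -/
theorem variational_inequality (hS : S.Admissible) {t τ : ℝ} {x y p : Z}
    (hy : y ∈ S.competitors τ x)
    (hmin : IsMinOn (S.stepEnergy t x) (S.competitors τ x) y) (hp : p ∈ S.competitors τ x) :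
    (S.load t - fderiv ℝ S.potential y) (p - y) + S.dissipation (y - x)
      ≤ S.dissipation (p - x) := by
  set c := S.dissipation (p - x) - S.dissipation (y - x) with hc
  have hd : HasDerivAt (fun s : ℝ => S.energy t (y + s • (p - y)) + s * c)
      ((fderiv ℝ S.potential y - S.load t) (p - y) + c) 0 := by
    have h0 : y + (0 : ℝ) • (p - y) = y := by simp
    have h1 := (h0.symm ▸ hS.hasFDerivAt_energy t y :
      HasFDerivAt (S.energy t) (fderiv ℝ S.potential y - S.load t)
        (y + (0 : ℝ) • (p - y))).comp_hasDerivAt (0 : ℝ) (hasDerivAt_segment y (p - y) 0)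
    exact (h1.add ((hasDerivAt_id (0 : ℝ)).mul_const c)).congr_deriv (by simp)
  -- Along the segment the nonsmooth term is replaced by its affine majorant, which agrees with it
  -- at `s = 0`; minimality persists and the function becomes differentiable.
  have hmin' : IsMinOn (fun s : ℝ => S.energy t (y + s • (p - y)) + s * c) (Icc 0 1) 0 := by
    intro s hs
    have hq : y + s • (p - y) ∈ S.competitors τ x :=
      (S.convex_competitors τ x).segment_subset hy hp (by
        rw [segment_eq_image']; exact ⟨s, hs, rfl⟩)
    have h1 : S.stepEnergy t x y ≤ S.stepEnergy t x (y + s • (p - y)) := hmin hq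
    have h2 : S.R (S.ι (y + s • (p - y) - x)) ≤
        (1 - s) * S.R (S.ι (y - x)) + s * S.R (S.ι (p - x)) := by
      have e1 : S.ι (y + s • (p - y) - x) = (1 - s) • S.ι (y - x) + s • S.ι (p - x) := by
        rw [← map_smul, ← map_smul, ← map_add]; congr 1; module
      rw [e1]
      exact hS.R_convex.2 (mem_univ _) (mem_univ _) (by linarith [hs.2]) hs.1 (by ring)
    simp only [stepEnergy] at h1
    simp only [mem_ofPred_eq, zero_smul, add_zero, zero_mul, hc, dissipation]
    linarith
  have h := hmin'.localize.hasFDerivWithinAt_nonneg (y := (1 : ℝ))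
    hd.hasFDerivAt.hasFDerivWithinAt
    (mem_posTangentConeAt_of_segment_subset (by rw [zero_add, segment_eq_Icc zero_le_one]))
  simp only [ContinuousLinearMap.toSpanSingleton_apply, one_smul, sub_apply] at h
  rw [sub_apply]
  linarith

/-- If the constraint of the scheme is inactive, the minimizer is locally stable and satisfies
the flow rule. -/
theorem stable_and_flow (hS : S.Admissible) {t τ : ℝ} {x y : Z}
    (hy : ‖S.ι (y - x)‖ < τ)
    (hmin : IsMinOn (S.stepEnergy t x) (S.competitors τ x) y) :
    (∀ w, (S.load t - fderiv ℝ S.potential y) w ≤ S.dissipation w) ∧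
      S.dissipation (y - x) = (S.load t - fderiv ℝ S.potential y) (y - x) := by
  have hyC : y ∈ S.competitors τ x := hy.le
  have hstab : ∀ w, (S.load t - fderiv ℝ S.potential y) w ≤ S.dissipation w := by
    intro w
    -- The slack of the inactive constraint admits a small move in any direction `w`.
    set ε := (τ - ‖S.ι (y - x)‖) / (‖S.ι w‖ + 1) with hε
    have hε0 : 0 < ε := div_pos (by linarith) (by positivity)
    have hp : y + ε • w ∈ S.competitors τ x := by
      have e1 : y + ε • w - x = (y - x) + ε • w := by abel
      have h1 : ε * ‖S.ι w‖ ≤ τ - ‖S.ι (y - x)‖ := by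
        rw [hε, div_mul_eq_mul_div, div_le_iff₀ (by positivity)]
        have : 0 < τ - ‖S.ι (y - x)‖ := by linarith
        nlinarith
      change ‖S.ι (y + ε • w - x)‖ ≤ τ
      rw [e1, map_add, map_smul]
      refine (norm_add_le _ _).trans ?_
      rw [norm_smul, Real.norm_eq_abs, abs_of_pos hε0]
      linarith
    have h1 := hS.variational_inequality hyC hmin hp
    have e1 : y + ε • w - x = (y - x) + ε • w := by abel
    have h2 : S.dissipation ((y - x) + ε • w) ≤ S.dissipation (y - x) + ε * S.dissipation w := by
      rw [← hS.dissipation_smul ε hε0]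
      simp only [dissipation, map_add]
      exact hS.R_add_le _ _
    rw [add_sub_cancel_left, map_smul, smul_eq_mul, e1] at h1
    exact le_of_mul_le_mul_left (by linarith) hε0
  refine ⟨hstab, le_antisymm ?_ (hstab _)⟩
  have h1 := hS.variational_inequality hyC hmin
    (S.self_mem_competitors ((norm_nonneg _).trans hy.le) x)
  rw [sub_self, hS.dissipation_zero, ← neg_sub y x, map_neg] at h1
  linarith

/-- Comparison of a minimizer with its locally stable predecessor. -/
theorem sq_norm_sub_le (hS : S.Admissible) {α L t t' τ : ℝ} {x y : Z}
    (hα : ∀ z, α * ‖z‖ ^ 2 ≤ S.A z z) (hL : ‖S.ℓ t - S.ℓ t'‖ ≤ L) (hL0 : 0 ≤ L)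
    (hx : ∀ w, (S.load t' - fderiv ℝ S.potential x) w ≤ S.dissipation w)
    (hy : y ∈ S.competitors τ x)
    (hmin : IsMinOn (S.stepEnergy t x) (S.competitors τ x) y) :
    α / 2 * ‖y - x‖ ^ 2 ≤ S.F x - S.F y + fderiv ℝ S.F x (y - x) + L * τ := by
  have hτ : 0 ≤ τ := (norm_nonneg _).trans hy
  have h1 : S.stepEnergy t x y ≤ S.stepEnergy t x x := hmin (S.self_mem_competitors hτ x)
  have h2 := hx (y - x)
  have h3 := hα (y - x)
  have h4 := S.load_sub_apply_le hL (y - x)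
  have h5 : L * ‖S.ι (y - x)‖ ≤ L * τ := by gcongr; exact hy
  have h6 := hS.A_add_add x (y - x)
  rw [add_sub_cancel] at h6
  rw [hS.fderiv_potential] at h2
  simp only [stepEnergy, energy_eq, potential, sub_self, map_zero, hS.R_zero] at h1
  simp only [sub_apply, add_apply, dissipation] at h2 h4
  have h7 : S.load t (y - x) = S.load t y - S.load t x := map_sub _ _ _
  linarith

/-- For small parameters `τ` the minimizers stay close to their locally stable predecessors. -/
theorem exists_norm_sub_le (hS : S.Admissible) (r L : ℝ) (hL0 : 0 ≤ L) {η : ℝ} (hη : 0 < η) :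
    ∃ τ₀ : ℝ, 0 < τ₀ ∧ ∀ (t t' τ : ℝ) (x y : Z), τ ≤ τ₀ → ‖S.ℓ t - S.ℓ t'‖ ≤ L →
      x ∈ Metric.ball (0 : Z) r →
      (∀ w, (S.load t' - fderiv ℝ S.potential x) w ≤ S.dissipation w) →
      y ∈ S.competitors τ x → IsMinOn (S.stepEnergy t x) (S.competitors τ x) y →
      ‖y - x‖ ≤ η := by
  obtain ⟨α, hα0, hα⟩ := hS.A_coercive
  rcases le_or_gt r 0 with hr | hr
  · refine ⟨1, one_pos, fun _ _ _ x _ _ _ hx => ?_⟩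
    simp [Metric.ball_eq_empty.2 hr] at hx
  obtain ⟨M₁, hM₁, hDF₁, hF₁⟩ := hS.exists_F_lipschitz r
  set b := S.F 0 + M₁ * r + M₁ + L with hb
  set ρ := 1 + 2 * (0 + |b|) / α with hρ
  have hρ0 : 0 ≤ ρ := by positivity
  obtain ⟨M₂, hM₂, hDF₂, hF₂⟩ := hS.exists_F_lipschitz (r + ρ)
  refine ⟨min 1 (α * η ^ 2 / (2 * (2 * M₂ + L + 1))), by positivity, ?_⟩
  intro t t' τ x y hτ hℓ hx hst hy hmin
  have hτ0 : 0 ≤ τ := (norm_nonneg _).trans hy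
  have hτ1 : τ ≤ 1 := hτ.trans (min_le_left _ _)
  have hcmp := hS.sq_norm_sub_le hα hℓ hL0 hst hy hmin
  have hxr := mem_ball_zero_iff.1 hx
  -- A crude bound first, from `τ ≤ 1` and `F ≥ 0`. It fixes the larger ball on which the Lipschitz
  -- constant `M₂` makes the estimate proportional to `τ`.
  have hbd : ‖y - x‖ ≤ ρ := by
    refine le_of_coercive hα0 le_rfl (norm_nonneg _) ?_
    have h1 := (abs_le.1 (hF₁ 0 (Metric.mem_ball_self hr) x hx)).2
    have h2 := (abs_le.1 (hDF₁ x hx (y - x))).2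
    have h3 : M₁ * ‖S.ι (y - x)‖ ≤ M₁ * 1 := by
      gcongr; exact le_trans hy hτ1
    have h4 : M₁ * ‖S.ι (x - 0)‖ ≤ M₁ * r := by
      gcongr; rw [sub_zero]; exact (hS.ι_norm_le x).trans hxr.le
    have h5 := hS.F_nonneg y
    have h6 : L * τ ≤ L * 1 := by gcongr
    rw [hb]; linarith
  have hx' : x ∈ Metric.ball (0 : Z) (r + ρ) := mem_ball_zero_iff.2 (by linarith)
  have hy' : y ∈ Metric.ball (0 : Z) (r + ρ) := mem_ball_zero_iff.2 (by
    have : ‖y‖ ≤ ‖x‖ + ‖y - x‖ := by simpa using norm_add_le x (y - x)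
    linarith)
  have h1 := (abs_le.1 (hF₂ x hx' y hy')).1
  have h2 := (abs_le.1 (hDF₂ x hx' (y - x))).2
  have h3 : M₂ * ‖S.ι (y - x)‖ ≤ M₂ * τ := by gcongr; exact hy
  have h4 : τ * (2 * (2 * M₂ + L + 1)) ≤ α * η ^ 2 := by
    have := hτ.trans (min_le_right _ _)
    rwa [le_div_iff₀ (by positivity)] at this
  have h5 : α / 2 * ‖y - x‖ ^ 2 ≤ α / 2 * η ^ 2 := by linarith
  have h6 : ‖y - x‖ ^ 2 ≤ η ^ 2 := le_of_mul_le_mul_left h5 (by positivity)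
  exact (sq_le_sq₀ (norm_nonneg _) hη.le).1 h6

/-- On segments of uniform convexity the minimizers depend on the load in a Lipschitz way. -/
theorem mul_norm_sub_le (hS : S.Admissible) {κ L t t' τ : ℝ} {x y : Z}
    (hκ : ∀ p ∈ segment ℝ x y, ∀ v, κ * ‖v‖ ^ 2 ≤ S.d2Energy t p v v)
    (hL : ‖S.ℓ t - S.ℓ t'‖ ≤ L)
    (hx : ∀ w, (S.load t' - fderiv ℝ S.potential x) w ≤ S.dissipation w)
    (hy : y ∈ S.competitors τ x)
    (hmin : IsMinOn (S.stepEnergy t x) (S.competitors τ x) y) :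
    κ * ‖y - x‖ ≤ L := by
  have hτ : 0 ≤ τ := (norm_nonneg _).trans hy
  have hL0 : 0 ≤ L := (norm_nonneg _).trans hL
  simp only [hS.d2Energy_eq] at hκ
  have h1 := mul_sq_le_fderiv_sub_apply hS.contDiff_potential hκ
  -- Comparison with standing still bounds the dissipation above, stability of `x` bounds it below,
  -- so the gradient increment is controlled by the load increment. The constraint may still be
  -- active here.
  have h2 := hS.variational_inequality hy hmin (S.self_mem_competitors hτ x)
  have h3 := hx (y - x)
  have h4 := S.load_sub_apply_le hL (y - x)
  have h5 : L * ‖S.ι (y - x)‖ ≤ L * ‖y - x‖ := by gcongr; exact hS.ι_norm_le _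
  rw [sub_self, hS.dissipation_zero, ← neg_sub y x, map_neg] at h2
  simp only [sub_apply] at h1 h2 h3 h4
  have h6 : κ * ‖y - x‖ * ‖y - x‖ ≤ L * ‖y - x‖ := by
    rw [mul_assoc, ← pow_two]; linarith
  rcases (norm_nonneg (y - x)).eq_or_lt with h0 | h0
  · rw [← h0, mul_zero]; exact hL0
  · exact le_of_mul_le_mul_right h6 h0

end System.Admissible

/-! ### Piecewise affine interpolants -/

section Interpolant

variable {E : Type*} [AddCommGroup E] [Module ℝ E] {τ : ℝ} {N : ℕ} {t : ℕ → ℝ}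

theorem affineInterpolant_apply (hτ : 0 < τ) (u : ℕ → E) {k : ℕ} {θ : ℝ} (h0 : 0 ≤ θ)
    (h1 : θ ≤ 1) : affineInterpolant τ u ((k + θ) * τ) = u k + θ • (u (k + 1) - u k) := by
  unfold affineInterpolant
  rw [mul_div_cancel_right₀ _ hτ.ne']
  -- At `θ = 1` the floor jumps to `k + 1`, where the neighbouring affine piece has the same value.
  rcases h1.eq_or_lt with rfl | h1
  · have : ⌊(k : ℝ) + 1⌋₊ = k + 1 := by exact_mod_cast Nat.floor_natCast (R := ℝ) (k + 1)
    rw [this]; simp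
  · have : ⌊(k : ℝ) + θ⌋₊ = k := by
      rw [Nat.floor_eq_iff (by positivity)]; constructor <;> linarith
    rw [this, add_sub_cancel_left]

/-- Parametrization of `[0, N τ]` by the index of the subinterval and the relative position. -/
theorem exists_eq_add_mul (hτ : 0 < τ) {s : ℝ} (hs : s ∈ Icc 0 (N * τ)) :
    ∃ (k : ℕ) (θ : ℝ), s = (k + θ) * τ ∧ 0 ≤ θ ∧ θ < 1 ∧ (k < N ∨ k = N ∧ θ = 0) := by
  have h0 : 0 ≤ s / τ := div_nonneg hs.1 hτ.le
  have h1 : s / τ ≤ N := (div_le_iff₀ hτ).2 hs.2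
  have h2 := Nat.floor_le h0
  have h3 := Nat.lt_floor_add_one (s / τ)
  refine ⟨⌊s / τ⌋₊, s / τ - ⌊s / τ⌋₊, by rw [add_sub_cancel, div_mul_cancel₀ _ hτ.ne'],
    by linarith, by linarith, ?_⟩
  rcases (Nat.floor_le_of_le h1).lt_or_eq with h | h
  · exact Or.inl h
  · refine Or.inr ⟨h, ?_⟩
    rw [h] at h2 ⊢; linarith

theorem le_of_forall_lt_succ (ht : ∀ k < N, t k < t (k + 1)) {j k : ℕ} (hjk : j ≤ k)
    (hk : k ≤ N) : t j ≤ t k := by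
  induction k, hjk using Nat.le_induction with
  | base => exact le_rfl
  | succ k _ ih => exact (ih (by omega)).trans (ht k (by omega)).le

theorem strictMonoOn_affineInterpolant (hτ : 0 < τ) (ht : ∀ k < N, t k < t (k + 1)) :
    StrictMonoOn (affineInterpolant τ t) (Icc 0 (N * τ)) := by
  intro s hs s' hs' hlt
  obtain ⟨k, θ, rfl, h0, h1, hk⟩ := exists_eq_add_mul hτ hs
  obtain ⟨k', θ', rfl, h0', h1', hk'⟩ := exists_eq_add_mul hτ hs'
  have hlt' : (k : ℝ) + θ < k' + θ' := lt_of_mul_lt_mul_right hlt hτ.le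
  rw [affineInterpolant_apply hτ t h0 h1.le, affineInterpolant_apply hτ t h0' h1'.le]
  simp only [smul_eq_mul]
  have hkk : k ≤ k' := by
    have : (k : ℝ) < k' + 1 := by linarith
    exact Nat.lt_succ_iff.1 (by exact_mod_cast this)
  have hkN : k < N := by
    rcases hk with hk | ⟨rfl, rfl⟩
    · exact hk
    · rcases hk' with hk' | ⟨rfl, rfl⟩
      · omega
      · simp at hlt'
  have hd := sub_pos.2 (ht k hkN)
  rcases hkk.eq_or_lt with rfl | hkk
  · have : θ < θ' := by linarith
    have := mul_lt_mul_of_pos_right this hd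
    linarith
  · have h2 : t k + θ * (t (k + 1) - t k) < t (k + 1) := by nlinarith
    have h3 : t (k + 1) ≤ t k' :=
      le_of_forall_lt_succ ht hkk (by rcases hk' with h | h <;> omega)
    have h4 : 0 ≤ θ' * (t (k' + 1) - t k') := by
      rcases hk' with hk' | ⟨-, rfl⟩
      · exact mul_nonneg h0' (sub_pos.2 (ht k' hk')).le
      · simp
    linarith

theorem exists_mem_Icc_succ {x : ℝ} (h0 : t 0 ≤ x) :
    ∀ {N : ℕ}, x ≤ t (N + 1) → ∃ k ≤ N, x ∈ Icc (t k) (t (k + 1)) := by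
  intro N
  induction N with
  | zero => exact fun h => ⟨0, le_rfl, h0, h⟩
  | succ N ih =>
    intro h
    rcases le_or_gt x (t (N + 1)) with h1 | h1
    · obtain ⟨k, hk, hx⟩ := ih h1
      exact ⟨k, by omega, hx⟩
    · exact ⟨N + 1, le_rfl, h1.le, h⟩

theorem bijOn_affineInterpolant (hτ : 0 < τ) (ht : ∀ k < N, t k < t (k + 1)) :
    BijOn (affineInterpolant τ t) (Icc 0 (N * τ)) (Icc (t 0) (t N)) := by
  have hmono := strictMonoOn_affineInterpolant hτ ht
  have hN : (0 : ℝ) ≤ N * τ := by positivity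
  have e0 : affineInterpolant τ t 0 = t 0 := by
    simpa using affineInterpolant_apply hτ t (k := 0) le_rfl zero_le_one
  have eN : affineInterpolant τ t (N * τ) = t N := by
    simpa using affineInterpolant_apply hτ t (k := N) le_rfl zero_le_one
  refine ⟨fun s hs => ⟨?_, ?_⟩, hmono.injOn, fun x hx => ?_⟩
  · rw [← e0]; exact hmono.monotoneOn ⟨le_rfl, hN⟩ hs hs.1
  · rw [← eN]; exact hmono.monotoneOn hs ⟨hN, le_rfl⟩ hs.2
  rcases N with _ | N
  · exact ⟨0, ⟨le_rfl, hN⟩, by rw [e0]; exact le_antisymm hx.1 hx.2⟩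
  obtain ⟨k, hk, hxk⟩ := exists_mem_Icc_succ hx.1 hx.2
  have hd := sub_pos.2 (ht k (by omega))
  have hθ0 : 0 ≤ (x - t k) / (t (k + 1) - t k) := div_nonneg (by linarith [hxk.1]) hd.le
  have hθ1 : (x - t k) / (t (k + 1) - t k) ≤ 1 := (div_le_one hd).2 (by linarith [hxk.2])
  refine ⟨(k + (x - t k) / (t (k + 1) - t k)) * τ, ⟨by positivity, ?_⟩, ?_⟩
  · have : (k : ℝ) ≤ N := by exact_mod_cast hk
    push_cast
    gcongr
  · rw [affineInterpolant_apply hτ t hθ0 hθ1, smul_eq_mul, div_mul_cancel₀ _ hd.ne']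
    ring

end Interpolant

/-! ### The scheme near a solution -/

/-- A differential solution in a region of uniform convexity is an `Evolution`. -/
theorem System.Admissible.exists_evolution [CompleteSpace Z] {S : System Z V X}
    (hS : S.Admissible)
    {z : ℝ → Z} (hz : S.IsDifferentialSolution z) {κ Δ : ℝ}
    (hconv : S.LocallyUniformlyConvex z κ Δ) {Λ : ℝ≥0} (hzΛ : LipschitzOnWith Λ z (Icc 0 S.T))
    (hℓΛ : LipschitzOnWith Λ S.ℓ (Icc 0 S.T)) (hBV : HasBVDeriv S.T S.ℓ) :
    ∃ (r C M : ℝ) (g : ℝ → Z →L[ℝ] ℝ) (v : ℝ → ℝ),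
      Evolution S.potential S.dissipation S.load z S.T κ Δ r C M Λ g v := by
  have hT := hS.T_pos
  obtain ⟨hκ, hΔ, hconv⟩ := hconv
  obtain ⟨z', hz', hflow⟩ := hz.2
  have hΛ := Λ.coe_nonneg
  have h0T : (0 : ℝ) ∈ Icc 0 S.T := ⟨le_rfl, hT.le⟩
  -- An open ball containing the whole `Δ`-tube around the trajectory.
  set r := ‖z 0‖ + Λ * S.T + Δ + 1 with hr
  obtain ⟨C, M, hC, hlip, hbd⟩ := hS.exists_second_bounds (r := r) (by positivity)
  obtain ⟨g, v, hv, hg, hℓ⟩ := hBV.exists_monotone hT.le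
  refine ⟨r, C, M, fun t => (g t).comp S.ι, v, hT, hκ, hΔ, hC, hS.contDiff_potential, hlip, hbd,
    fun t ht y hy w => ?_, fun t ht y hy => ?_, hzΛ, hS.dissipation_smul, ?_, fun s hs t ht => ?_,
    hv, fun a ha b hb hab => ?_, fun a ha b hb hab => ?_⟩
  · rw [← hS.d2Energy_eq t]
    exact hconv t ht y hy w
  · rw [mem_closedBall_iff_norm] at hy
    rw [mem_ball_zero_iff]
    have h1 := hzΛ.dist_le_mul t ht 0 h0T
    rw [dist_eq_norm, Real.dist_eq, sub_zero, abs_of_nonneg ht.1] at h1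
    have h2 : (Λ : ℝ) * t ≤ Λ * S.T := by gcongr; exact ht.2
    have h3 : y = (y - z t) + (z t - z 0) + z 0 := by abel
    have h4 : ‖y‖ ≤ ‖y - z t‖ + ‖z t - z 0‖ + ‖z 0‖ := by
      conv_lhs => rw [h3]
      exact norm_add₃_le
    linarith
  · have h1 := (ae_restrict_iff' measurableSet_Icc).1 hflow
    filter_upwards [hz'.ae_hasDerivAt hT.le, h1] with t ht1 ht2 htI
    refine ⟨z' t, ht1 htI, ?_⟩
    have h2 := ht2 (Ioo_subset_Icc_self htI)
    rwa [hS.neg_dEnergy_eq, hS.mem_subdifferential_dissipation] at h2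
  · have h1 := hℓΛ.dist_le_mul t ht s hs
    rw [dist_eq_norm, Real.dist_eq] at h1
    exact (hS.norm_comp_ι_le (S.ℓ t - S.ℓ s)).trans h1
  · exact (hS.norm_comp_ι_le (g b - g a)).trans (hg a ha b hb hab)
  · exact (hS.norm_comp_ι_le (S.ℓ b - S.ℓ a - (b - a) • g a)).trans (hℓ a ha b hb hab)

namespace System.IsLocalMinScheme

variable {S : System Z V X} {τ : ℝ} {t : ℕ → ℝ} {y : ℕ → Z}

theorem t_le (h : S.IsLocalMinScheme τ t y) (hS : S.Admissible) (k : ℕ) : t k ≤ S.T := by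
  rcases k with _ | k
  · rw [h.t_zero]; exact hS.T_pos.le
  · rw [h.t_succ]; exact min_le_right _ _

theorem t_le_succ (h : S.IsLocalMinScheme τ t y) (hS : S.Admissible) (k : ℕ) :
    t k ≤ t (k + 1) := by
  rw [h.t_succ]
  exact le_min (by linarith [h.step_le k]) (h.t_le hS k)

theorem t_sub_le (h : S.IsLocalMinScheme τ t y) (k : ℕ) : t (k + 1) - t k ≤ τ := by
  rw [h.t_succ]
  linarith [min_le_left (t k + τ - ‖S.ι (y (k + 1) - y k)‖) S.T,
    norm_nonneg (S.ι (y (k + 1) - y k))]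

theorem mem_Icc (h : S.IsLocalMinScheme τ t y) (hS : S.Admissible) (k : ℕ) :
    t k ∈ Icc 0 S.T :=
  ⟨h.t_zero ▸ monotone_nat_of_le_succ (h.t_le_succ hS) (Nat.zero_le k), h.t_le hS k⟩

/-- The `k`-th iterate of the scheme is an implicit Euler step with inactive constraint. -/
structure GoodStep (S : System Z V X) (z : ℝ → Z) (q ε : ℝ) (t : ℕ → ℝ) (y : ℕ → Z) (k : ℕ) :
    Prop where
  stable : ∀ w, (S.load (t k) - fderiv ℝ S.potential (y (k + 1))) w ≤ S.dissipation w
  flow : S.dissipation (y (k + 1) - y k)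
    = (S.load (t k) - fderiv ℝ S.potential (y (k + 1))) (y (k + 1) - y k)
  norm_sub_le : ‖y (k + 1) - y k‖ ≤ q * (t k - t (k - 1))
  close : ‖y (k + 1) - z (t k)‖ ≤ ε

/-- At `k = 0` truncated subtraction makes the left side zero, matching a fictitious earlier step of
length zero. -/
theorem sub_pred_le (h : S.IsLocalMinScheme τ t y) (hτ : 0 ≤ τ) (k : ℕ) :
    t k - t (k - 1) ≤ τ := by
  rcases k with _ | k
  · simpa using hτ
  · exact h.t_sub_le k

theorem GoodStep.norm_ι_sub_le {z : ℝ → Z} {q ε : ℝ} {k : ℕ} (h : S.IsLocalMinScheme τ t y)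
    (hS : S.Admissible) (hτ : 0 ≤ τ) (hq : 0 ≤ q) (hk : GoodStep S z q ε t y k) :
    ‖S.ι (y (k + 1) - y k)‖ ≤ q * τ :=
  (hS.ι_norm_le _).trans (hk.norm_sub_le.trans (by gcongr; exact h.sub_pred_le hτ k))

/-- A good step spends at most `q τ` of the budget `τ`, so time advances. -/
theorem GoodStep.lt_succ {z : ℝ → Z} {q ε : ℝ} {k : ℕ} (h : S.IsLocalMinScheme τ t y)
    (hS : S.Admissible) (hτ : 0 < τ) (hq : 0 ≤ q) (hq1 : q < 1) (hk : GoodStep S z q ε t y k)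
    (hkT : t k < S.T) : t k < t (k + 1) := by
  rw [h.t_succ]
  have := hk.norm_ι_sub_le h hS hτ.le hq
  exact lt_min (by nlinarith) hkT

/-- Before the final time is reached, all iterates of the scheme are good steps. -/
theorem exists_goodStep (hS : S.Admissible) {z : ℝ → Z} (hz0 : z 0 = S.z₀) {κ Δ r C M : ℝ}
    {Λ : ℝ≥0} {g : ℝ → Z →L[ℝ] ℝ} {v : ℝ → ℝ}
    (E : Evolution S.potential S.dissipation S.load z S.T κ Δ r C M Λ g v)
    {L : ℝ≥0} (hL : LipschitzOnWith L S.ℓ (Icc 0 S.T)) (hLκ : (L : ℝ) < κ) :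
    ∃ K : ℝ, 0 < K ∧ ∃ τbar : ℝ, 0 < τbar ∧ ∀ (τ : ℝ) (t : ℕ → ℝ) (y : ℕ → Z), 0 < τ → τ ≤ τbar →
      S.IsLocalMinScheme τ t y →
      ∀ k, (∀ j < k, t j < S.T) → ∀ j ≤ k, GoodStep S z (L / κ) (K * τ) t y j := by
  have hκ := E.κ_pos
  have hΔ := E.Δ_pos
  have hΛ := Λ.coe_nonneg
  have hq0 : 0 ≤ (L : ℝ) / κ := div_nonneg L.coe_nonneg hκ.le
  have hq1 : (L : ℝ) / κ < 1 := (div_lt_one hκ).2 hLκ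
  obtain ⟨K, hK0, hK⟩ := E.exists_error_bound
  obtain ⟨τ₀, hτ₀, hstep⟩ := hS.exists_norm_sub_le r (L * S.T)
    (mul_nonneg L.coe_nonneg hS.T_pos.le) (half_pos hΔ)
  refine ⟨K, hK0, min τ₀ (Δ / (2 * (K + 1 + Λ))), by positivity, ?_⟩
  intro τ t y hτ hτbar h
  have hττ₀ : τ ≤ τ₀ := hτbar.trans (min_le_left _ _)
  have hτΔ : τ * (2 * (K + 1 + Λ)) ≤ Δ := by
    have := hτbar.trans (min_le_right _ _)
    rwa [le_div_iff₀ (by positivity)] at this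
  have hKτ : 0 < K * τ := mul_pos hK0 hτ
  have hΛτ : 0 ≤ Λ * τ := mul_nonneg hΛ hτ.le
  have hℓ : ∀ j k : ℕ, j ≤ k → ‖S.ℓ (t k) - S.ℓ (t j)‖ ≤ L * (t k - t j) := fun j k hjk => by
    have h1 := hL.dist_le_mul _ (h.mem_Icc hS k) _ (h.mem_Icc hS j)
    rwa [dist_eq_norm, Real.dist_eq, abs_of_nonneg
      (sub_nonneg.2 (monotone_nat_of_le_succ (h.t_le_succ hS) hjk))] at h1
  -- one step, starting from a locally stable state near the solution
  have one : ∀ k, (∀ w, (S.load (t (k - 1)) - fderiv ℝ S.potential (y k)) w ≤ S.dissipation w) →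
      ‖y k - z (t k)‖ ≤ Δ / 2 → ‖y (k + 1) - y k‖ ≤ L / κ * (t k - t (k - 1)) ∧
      (∀ w, (S.load (t k) - fderiv ℝ S.potential (y (k + 1))) w ≤ S.dissipation w) ∧
      S.dissipation (y (k + 1) - y k)
        = (S.load (t k) - fderiv ℝ S.potential (y (k + 1))) (y (k + 1) - y k) := by
    intro k hst hclose
    have hkI := h.mem_Icc hS k
    have hyk : y k ∈ Metric.closedBall (z (t k)) Δ := by
      rw [mem_closedBall_iff_norm]; linarith
    have hmin : IsMinOn (S.stepEnergy (t k) (y k)) (S.competitors τ (y k)) (y (k + 1)) :=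
      h.isMinOn k
    have hℓk := hℓ (k - 1) k (Nat.sub_le k 1)
    -- The a priori bound places the minimizer inside the convex region before convexity is invoked.
    have h1 : ‖y (k + 1) - y k‖ ≤ Δ / 2 := by
      refine hstep (t k) (t (k - 1)) τ _ _ hττ₀ (hℓk.trans ?_) (E.ball_subset _ hkI hyk) hst
        (h.step_le k) hmin
      have := (h.mem_Icc hS (k - 1)).1
      gcongr
      linarith [hkI.2]
    have hyk' : y (k + 1) ∈ Metric.closedBall (z (t k)) Δ := by
      rw [mem_closedBall_iff_norm]
      have e1 : y (k + 1) - z (t k) = (y (k + 1) - y k) + (y k - z (t k)) := by abel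
      rw [e1]
      linarith [norm_add_le (y (k + 1) - y k) (y k - z (t k))]
    have h2 : κ * ‖y (k + 1) - y k‖ ≤ L * (t k - t (k - 1)) := by
      refine hS.mul_norm_sub_le (fun p hp w => ?_) hℓk hst (h.step_le k) hmin
      rw [hS.d2Energy_eq]
      exact E.convex _ hkI p ((convex_closedBall _ _).segment_subset hyk hyk' hp) w
    have h3 : ‖y (k + 1) - y k‖ ≤ L / κ * (t k - t (k - 1)) := by
      rw [div_mul_eq_mul_div, le_div_iff₀ hκ, mul_comm]; exact h2
    -- Since `L / κ < 1`, the increment stays strictly below `τ` and the constraint is inactive.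
    refine ⟨h3, hS.stable_and_flow (t := t k) (τ := τ) ?_ hmin⟩
    have h4 : L / κ * (t k - t (k - 1)) ≤ L / κ * τ := by
      gcongr; exact h.sub_pred_le hτ.le k
    have h5 : L / κ * τ < τ := by nlinarith
    linarith [hS.ι_norm_le (y (k + 1) - y k)]
  intro k
  induction k with
  | zero =>
    intro _ j hj
    obtain rfl : j = 0 := by omega
    have hz0' : ‖y 0 - z (t 0)‖ = 0 := by rw [h.t_zero, h.z_zero, hz0]; simp
    have hst := (hS.mem_subdifferential_dissipation.1 hS.z₀_stable).2
    rw [hS.neg_dEnergy_eq] at hst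
    obtain ⟨h1, h2, h3⟩ := one 0 (by rw [zero_tsub, h.t_zero, h.z_zero]; exact hst)
      (by rw [hz0']; positivity)
    refine ⟨h2, h3, h1, ?_⟩
    have e1 : y (0 + 1) - z (t 0) = (y (0 + 1) - y 0) + (y 0 - z (t 0)) := by abel
    -- With `0 - 1 = 0` the load increment vanishes, so the first step does not move.
    rw [zero_tsub, sub_self, mul_zero] at h1
    rw [e1]
    linarith [norm_add_le (y (0 + 1) - y 0) (y 0 - z (t 0))]
  | succ k ih =>
    intro hlt j hj
    have ih := ih fun j hj => hlt j (by omega)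
    rcases hj.lt_or_eq with hj | rfl
    · exact ih j (by omega)
    have hinc : ∀ j ≤ k, t j < t (j + 1) := fun j hj =>
      (ih j hj).lt_succ h hS hτ hq0 hq1 (hlt j (by omega))
    have hzk := E.norm_sub_le (h.mem_Icc hS k) (h.mem_Icc hS (k + 1))
    rw [abs_of_pos (sub_pos.2 (hinc k le_rfl))] at hzk
    have hzk' : (Λ : ℝ) * (t (k + 1) - t k) ≤ Λ * τ := by gcongr; exact h.t_sub_le k
    have hclose : ‖y (k + 1) - z (t (k + 1))‖ ≤ Δ / 2 := by
      have e1 : y (k + 1) - z (t (k + 1)) = (y (k + 1) - z (t k)) - (z (t (k + 1)) - z (t k)) := by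
        abel
      rw [e1]
      linarith [norm_sub_le (y (k + 1) - z (t k)) (z (t (k + 1)) - z (t k)),
        (ih k le_rfl).close]
    obtain ⟨h1, h2, h3⟩ := one (k + 1) (ih k le_rfl).stable hclose
    refine ⟨h2, h3, h1, ?_⟩
    -- Shifting by one pairs the state `y (j + 1)` with the load at `t j` used to compute it, which
    -- makes the explicit-looking scheme an implicit one.
    refine hK τ hτ (by linarith) (k + 1) t (fun j => y (j + 1)) ?_
    have hnorm : ∀ j ≤ k, ‖y (j + 1 + 1) - y (j + 1)‖ ≤ t (j + 1) - t j := fun j hj => by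
      have h4 : ‖y (j + 1 + 1) - y (j + 1)‖ ≤ L / κ * (t (j + 1) - t j) := by
        rcases hj.lt_or_eq with hj | rfl
        · exact (ih (j + 1) hj).norm_sub_le
        · exact h1
      exact h4.trans (mul_le_of_le_one_left (sub_nonneg.2 (hinc j hj).le) hq1.le)
    refine ⟨h.t_zero, ?_, fun j hj => hinc j (by omega), fun j _ => h.t_sub_le j, h.t_le hS _,
      fun j hj => hnorm j (by omega), fun j hj => ?_, fun j hj => ?_, fun j hj => ?_⟩
    · have h4 := (ih 0 (Nat.zero_le k)).norm_sub_le
      rw [zero_tsub, sub_self, mul_zero] at h4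
      change y (0 + 1) = z 0
      rw [sub_eq_zero.1 (norm_le_zero_iff.1 h4), h.z_zero, hz0]
    · rcases hj.lt_or_eq with hj | rfl
      · exact (ih j (by omega)).stable
      · exact h2
    · rcases (Nat.lt_succ_iff.1 hj).lt_or_eq with hj | rfl
      · exact (ih (j + 1) hj).flow
      · exact h3
    · have := (ih j (by omega)).close
      change ‖y (j + 1) - z (t j)‖ ≤ Δ / 2
      linarith

/-- If all iterates before the final time are good steps, then the final time is reached. -/
theorem exists_eq_T (h : S.IsLocalMinScheme τ t y) (hS : S.Admissible) {z : ℝ → Z} {q ε : ℝ}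
    (hτ : 0 < τ) (hq : 0 ≤ q) (hq1 : q < 1)
    (hgood : ∀ k, (∀ j < k, t j < S.T) → ∀ j ≤ k, GoodStep S z q ε t y j) :
    ∃ k, t k = S.T := by
  by_contra! hne
  have hlt : ∀ k, t k < S.T := fun k => lt_of_le_of_ne (h.t_le hS k) (hne k)
  have hgrow : ∀ k : ℕ, k * ((1 - q) * τ) ≤ t k := fun k => by
    induction k with
    | zero => simp [h.t_zero]
    | succ k ih =>
      have h1 := (hgood k (fun j _ => hlt j) k le_rfl).norm_ι_sub_le h hS hτ.le hq
      have h2 := h.t_succ k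
      -- The truncation at `T` cannot be active if `T` is never reached.
      have h3 : t (k + 1) = t k + τ - ‖S.ι (y (k + 1) - y k)‖ := by
        rcases min_choice (t k + τ - ‖S.ι (y (k + 1) - y k)‖) S.T with h4 | h4
        · rw [h2, h4]
        · exact absurd (h2.trans h4) (hne _)
      push_cast
      linarith
  obtain ⟨n, hn⟩ := exists_nat_gt (S.T / ((1 - q) * τ))
  rw [div_lt_iff₀ (mul_pos (by linarith) hτ)] at hn
  linarith [hgrow n, hlt n]

end System.IsLocalMinScheme
end LocalMin

/-! ### Estimate of the back-transformed solution. -/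

open LocalMin in
theorem theorem3p18 {Z V X : Type*}
    [NormedAddCommGroup Z] [InnerProductSpace ℝ Z] [CompleteSpace Z]
    [NormedAddCommGroup V] [InnerProductSpace ℝ V] [CompleteSpace V]
    [NormedAddCommGroup X] [NormedSpace ℝ X] [CompleteSpace X]
    (S : LocalMin.System Z V X) (hS : S.Admissible)
    (z : ℝ → Z) (hz : S.IsDifferentialSolution z)
    (hzLip : ∃ Lz : ℝ≥0, LipschitzOnWith Lz z (Icc 0 S.T))
    (κ Δ : ℝ) (hconv : S.LocallyUniformlyConvex z κ Δ)
    (δ : ℝ) (hδ : 0 < δ) (hδκ : δ ≤ κ)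
    (L : ℝ≥0) (hL : LipschitzOnWith L S.ℓ (Icc 0 S.T)) (hLκ : (L : ℝ) ≤ κ - δ)
    (hBV : LocalMin.HasBVDeriv S.T S.ℓ) :
    ∃ K : ℝ, 0 < K ∧ ∃ τbar : ℝ, 0 < τbar ∧ ∀ τ : ℝ, 0 < τ → τ ≤ τbar →
      (∃ (t : ℕ → ℝ) (y : ℕ → Z), S.IsLocalMinScheme τ t y) ∧
      ∀ (t : ℕ → ℝ) (y : ℕ → Z), S.IsLocalMinScheme τ t y →
        -- the final time is reached
        (∃ k, t k = S.T) ∧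
        -- the back-transformation exists
        StrictMonoOn (LocalMin.affineInterpolant τ t)
          (Icc 0 (LocalMin.artificialEnd S.T τ t)) ∧
        BijOn (LocalMin.affineInterpolant τ t)
          (Icc 0 (LocalMin.artificialEnd S.T τ t)) (Icc 0 S.T) ∧
        -- the back-transformed solution stays in the region of convexity and converges with rate one
        ∀ x ∈ Icc (0 : ℝ) S.T,
          LocalMin.backTransformed S.T τ t y x ∈ Metric.ball (z x) Δ ∧
          ‖LocalMin.backTransformed S.T τ t y x - z x‖ ≤ K * τ := by
  obtain ⟨Lz, hLz⟩ := hzLip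
  obtain ⟨r, C, M, g, v, E⟩ := hS.exists_evolution hz hconv (hLz.weaken (le_max_left Lz L))
    (hL.weaken (le_max_right Lz L)) hBV
  set Λ := max Lz L
  have hκ := E.κ_pos
  have hΔ := E.Δ_pos
  have hΛ := Λ.coe_nonneg
  have hLκ' : (L : ℝ) < κ := by linarith
  have hq0 : 0 ≤ (L : ℝ) / κ := div_nonneg L.coe_nonneg hκ.le
  have hq1 : (L : ℝ) / κ < 1 := (div_lt_one hκ).2 hLκ'
  obtain ⟨K, hK, τ₁, hτ₁, hgood⟩ :=
    System.IsLocalMinScheme.exists_goodStep hS hz.1 E hL hLκ'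
  refine ⟨K + 1 + Λ, by positivity, min τ₁ (Δ / (2 * (K + 1 + Λ))), by positivity, ?_⟩
  intro τ hτ hτbar
  refine ⟨hS.exists_isLocalMinScheme hτ.le, fun t y h => ?_⟩
  have hgood := hgood τ t y hτ (hτbar.trans (min_le_left _ _)) h
  have hreach := h.exists_eq_T hS hτ hq0 hq1 hgood
  set N := stepCount S.T t with hN
  have hNT : t N = S.T := Nat.sInf_mem hreach
  have hltT : ∀ k < N, t k < S.T := fun k hk =>
    lt_of_le_of_ne (h.t_le hS k) fun hk' => Nat.notMem_of_lt_sInf hk hk'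
  -- The index `N` itself is included: the right endpoint is parametrized by `k = N`, `θ = 0`, and
  -- its estimate refers to `y (N + 1)`.
  have hgood := hgood N hltT
  have hlt : ∀ k < N, t k < t (k + 1) := fun k hk =>
    (hgood k hk.le).lt_succ h hS hτ hq0 hq1 (hltT k hk)
  have hend : artificialEnd S.T τ t = N * τ := rfl
  have hbij : BijOn (affineInterpolant τ t) (Icc 0 (artificialEnd S.T τ t)) (Icc 0 S.T) := by
    have := bijOn_affineInterpolant hτ hlt
    rwa [h.t_zero, hNT] at this
  refine ⟨hreach, strictMonoOn_affineInterpolant hτ hlt, hbij, fun x hx => ?_⟩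
  have hle : ‖backTransformed S.T τ t y x - z x‖ ≤ (K + 1 + Λ) * τ := by
    have hmem := Function.invFunOn_mem (hbij.surjOn hx)
    have heq := Function.invFunOn_eq (hbij.surjOn hx)
    unfold backTransformed
    set s := Function.invFunOn (affineInterpolant τ t) (Icc 0 (artificialEnd S.T τ t)) x
    obtain ⟨k, θ, hs, hθ0, hθ1, hk⟩ := exists_eq_add_mul hτ (hend ▸ hmem)
    rw [hs, affineInterpolant_apply hτ t hθ0 hθ1.le, smul_eq_mul] at heq
    rw [hs, affineInterpolant_apply hτ y hθ0 hθ1.le]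
    have hkN : k ≤ N := by rcases hk with hk | ⟨hk, -⟩ <;> omega
    have hgk := hgood k hkN
    have hd0 := sub_nonneg.2 (h.t_le_succ hS k)
    have h1 : ‖(1 - θ) • (y (k + 1) - y k)‖ ≤ τ := by
      rw [norm_smul, Real.norm_eq_abs, abs_of_pos (by linarith)]
      refine (mul_le_of_le_one_left (norm_nonneg _) (by linarith)).trans
        (hgk.norm_sub_le.trans ?_)
      have h2 := h.sub_pred_le hτ.le k
      have h3 := mul_le_mul_of_nonneg_left h2 hq0
      nlinarith
    have h2 : ‖z x - z (t k)‖ ≤ Λ * τ := by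
      refine (E.norm_sub_le (h.mem_Icc hS k) hx).trans ?_
      rw [← heq, add_sub_cancel_left, abs_of_nonneg (mul_nonneg hθ0 hd0)]
      gcongr
      exact (mul_le_of_le_one_left hd0 hθ1.le).trans (h.t_sub_le k)
    -- The reference pair is `y (k + 1)` and `z (t k)`, for which the error bound holds; the two
    -- corrections cost `τ` and `Λ τ`.
    have e1 : y k + θ • (y (k + 1) - y k) - z x = (y (k + 1) - z (t k))
        - (1 - θ) • (y (k + 1) - y k) - (z x - z (t k)) := by module
    rw [e1]
    linarith [norm_sub_le (y (k + 1) - z (t k) - (1 - θ) • (y (k + 1) - y k)) (z x - z (t k)),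
      norm_sub_le (y (k + 1) - z (t k)) ((1 - θ) • (y (k + 1) - y k)), hgk.close]
  refine ⟨?_, hle⟩
  rw [mem_ball_iff_norm]
  -- The factor 2 in the threshold leaves an error of at most `Δ / 2`, hence strict inequality.
  have h1 := hτbar.trans (min_le_right _ _)
  rw [le_div_iff₀ (by positivity)] at h1
  linarith
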